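/- Let $0\le\nu<\frac13$ and $d\ge 1$ be constants and put $K_{\max}(N)=\left\lfloor \frac{1-3\nu}{d}N+1-\frac1d\right\rfloor$. **Setting.** Let $\mathbb F$ be a field with at least $N$ elements. A state machine has a state space $\mathbb S=\mathbb F^{n_S}$ ($n_S\ge1$), an input alphabet $\mathbb F^{n_X}$, an output alphabet $\mathbb F^{n_Y}$ and a transition function $(S(t+1),Y(t))=f(S(t),X(t))$ whose coordinates are multivariate polynomials of total degree at most $d$. A set of $M\ge1$ clients keeps submitting commands to each of $K$ such machines (with the same $f$) by broadcasting them to $N$ nodes. The nodes and the clients form a partially synchronous network: messages between honest parties are never lost; their delay is unbounded until an unknown global stabilization time, and at most a known bound $\Delta$ from then on. Faulty nodes are subject to authenticated Byzantine faults: they may behave arbitrarily, but cannot forge the signature of another (honest) node. A computation scheme consists of a storage design, by which node $i$ at round $t$ stores some $Z_i(t)\in\mathbb W=\mathbb F^{w}$ that is a function of the $K$ states $S_1(t),\dots,S_K(t)$; a consensus protocol, by which the nodes agree in every round $t$ on input commands $X_1(t),\dots,X_K(t)$; and an execution phase, in which node $i$ computes a local result from $Z_i(t)$ and the agreed commands,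 multicasts it, recovers next states and outputs from the local results it has received, returns the outputs to the clients who submitted the commands, and updates $Z_i(t)$ to $Z_i(t+1)$ from the recovered states; each client decides on an output from the replies it receives. The scheme is $b$-secure if, for every set of at most $b$ faulty nodes and in every run: every command selected for machine $k$ has been submitted to machine $k$ by some client before (validity); no two honest nodes decide on different commands for the same round (consistency); the next states recovered by honest nodes and the outputs decided on by the clients are the true ones (correctness); and every submitted command is eventually executed by all honest nodes and answered to its client (liveness). Its security $\beta$ is the maximum $b$ for which it is $b$-secure, and its storage efficiency is $\gamma=\frac{K\log|\mathbb S|}{\log|\mathbb W|}$ (with dimensions in place of logarithms of cardinalities if $\mathbb F$ is infinite). **Theorem.** For every such system of $N$ nodes and every $1\le K\le K_{\max}(N)$ there is a computation scheme that operates $K$ state machines with transition function $f$ and simultaneously achieves storage efficiency $\gamma=K$ and security $\beta=\lfloor\nu N\rfloor$. In particular, if $K_{\max}(N)\ge1$, the storage efficiency $\gamma=K_{\max}(N)$ is achieved together with security $\beta=\lfloor\nu N\rfloor$. Moreover $K_{\max}(N)=\Theta(N)$, and $\lfloor\nu N\rfloor=\Theta(N)$ if $\nu>0$, as $N\to\infty$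 with $\nu$ and $d$ fixed. -/

import Mathlib

open Filter Asymptotics

universe u

namespace CodedSM

/-! ## State machines -/

/-- A deterministic state machine with state space `F^nS`, input alphabet `F^nX` and output alphabet
`F^nY`, whose transition function is given by multivariate polynomials: one for every coordinate of
the next state and one for every coordinate of the output, in the coordinates of state and input. -/
structure PolyMachine (F : Type u) [Field F] (nS nX nY : ℕ) where
  next : Fin nS → MvPolynomial (Fin nS ⊕ Fin nX) F
  out : Fin nY → MvPolynomial (Fin nS ⊕ Fin nX) F

namespace PolyMachine

variable {F : Type u} [Field F] {nS nX nY : ℕ}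

/-- The transition function `(S(t), X(t)) ↦ (S(t+1), Y(t))`. -/
noncomputable def step (p : PolyMachine F nS nX nY) (s : Fin nS → F) (x : Fin nX → F) :
    (Fin nS → F) × (Fin nY → F) :=
  (fun i => MvPolynomial.eval (Sum.elim s x) (p.next i),
   fun i => MvPolynomial.eval (Sum.elim s x) (p.out i))

/-- All the defining polynomials have total degree at most `d`. -/
def DegreeLE (p : PolyMachine F nS nX nY) (d : ℕ) : Prop :=
  (∀ i, (p.next i).totalDegree ≤ d) ∧ ∀ i, (p.out i).totalDegree ≤ d

end PolyMachine

/-! ## Computation schemes -/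

/-- A command submitted to a state machine: the submitting client, the time of submission (which
serves as the client's time stamp), and the input command itself. -/
structure Request (F : Type u) (M nX : ℕ) where
  client : Fin M
  stamp : ℕ
  cmd : Fin nX → F

/-- A consensus protocol for `N` nodes: a deterministic automaton for every node, taking one step
per unit of time. A signed statement is a pair `(j, c)`, meaning "content `c` signed by node `j`".
In every unit of time a node is handed the set of signed statements and the set of client requests
(with the machine each one is addressed to) that have just arrived, and sends to each node a set of
signed statements. `decided i q t` is the vector of input commands, one for each of the `K`
machines, on which node `i` in state `q` has decided for round `t` (`none` if undecided). -/
structure Consensus (F : Type u) (N M K nX : ℕ) where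
  State : Type u
  Content : Type u
  start : Fin N → State
  step : Fin N → State → Set (Fin N × Content) → Set (Fin K × Request F M nX) → State
  send : Fin N → State → Fin N → Set (Fin N × Content)
  decided : Fin N → State → ℕ → Option (Fin K → Request F M nX)

/-- A computation scheme for running `K` state machines with state space `F^nS`, input alphabet
`F^nX` and output alphabet `F^nY` on `N` nodes serving `M` clients. -/
structure Scheme (F : Type u) [Field F] (N M K nS nX nY : ℕ) where
  /-- the protocol of the consensus phase -/
  consensus : Consensus F N M K nX
  /-- each node stores one element of `F^storeDim` -/
  storeDim : ℕ
  /-- `φ_i^t`: the data that node `i` is to store at round `t`, as a function of the states -/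
  encode : ℕ → Fin N → (Fin K → Fin nS → F) → (Fin storeDim → F)
  /-- the type of local computation results -/
  Result : Type u
  /-- `ρ_i^t`: the local computation, from the stored data and the agreed commands -/
  compute : ℕ → Fin N → (Fin storeDim → F) → (Fin K → Fin nX → F) → Result
  /-- the nodes to which node `i` multicasts its local result of round `t` -/
  dest : ℕ → Fin N → Finset (Fin N)
  /-- `𝒦_i^t`: the machines whose next state and output node `i` recovers in round `t` -/
  covers : ℕ → Fin N → Finset (Fin K)
  /-- `ψ_i^t`: recovery of next states and outputs from the local results available so far
  (a partial family, indexed by the computing node); `none` means that the node keeps waiting -/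
  decode : (t : ℕ) → (i : Fin N) → (Fin N → Option Result) →
    Option (↥(covers t i) → (Fin nS → F) × (Fin nY → F))
  /-- `χ_i^t`: update of the stored data -/
  update : (t : ℕ) → (i : Fin N) → (Fin storeDim → F) → (↥(covers t i) → Fin nS → F) →
    (Fin storeDim → F)
  /-- the update turns the encoding of the current states into the encoding, for the next round, of
  the states of which those recovered by the node have been replaced by their new values -/
  update_encode : ∀ t i (s s' : Fin K → Fin nS → F),
    update t i (encode t i s) (fun k => s' k) =
      encode (t + 1) i (fun k => if k ∈ covers t i then s' k else s k)
  /-- how a client decides on the output of round `t` of machine `k`, from the outputs reported to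
  it so far (indexed by the reporting node); `none` means that the client keeps waiting -/
  clientDecide : ℕ → Fin K → (Fin N → Option (Fin nY → F)) → Option (Fin nY → F)

/-- What has arrived by time `τ`, given the arrival time and the value of a message (if any). -/
def arrivedBy {α : Type u} (τ : ℕ) : Option (ℕ × α) → Option α
  | none => none
  | some (a, v) => if a ≤ τ then some v else none

variable {F : Type u} [Field F] {N M K nS nX nY : ℕ}

/-! ## Runs over a partially synchronous network -/

/-- The data of a run of the scheme `P`. Time is discrete; the values of `st`, `round` and `store`
are meaningful for honest nodes only. -/
structure RunData (P : Scheme F N M K nS nX nY) where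
  /-- the global stabilization time -/
  gst : ℕ
  /-- the initial states of the machines -/
  s₀ : Fin K → Fin nS → F
  /-- `submit τ m k` is the command (if any) that client `m` submits to machine `k` at time `τ`,
  by broadcasting it to all nodes -/
  submit : ℕ → Fin M → Fin K → Option (Fin nX → F)
  /-- `submitArr τ m k i` is the time at which that command arrives at node `i` -/
  submitArr : ℕ → Fin M → Fin K → Fin N → ℕ
  /-- `sent τ i j` is the set of signed statements of the consensus phase that node `i` sends to
  node `j` at time `τ` -/
  sent : ℕ → Fin N → Fin N → Set (Fin N × P.consensus.Content)
  /-- `sentArr τ i j` is the time at which these statements arrive -/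
  sentArr : ℕ → Fin N → Fin N → ℕ
  /-- the state of the consensus automaton of a node at a given time -/
  st : ℕ → Fin N → P.consensus.State
  /-- the round of which the execution phase a node has to perform next, at a given time -/
  round : ℕ → Fin N → ℕ
  /-- the data stored at a node at a given time -/
  store : ℕ → Fin N → (Fin P.storeDim → F)
  /-- `result t i j` is the first local result for round `t` from node `i` that reaches node `j`,
  with its time of arrival (a receiver ignores later results from the same node for that round) -/
  result : ℕ → Fin N → Fin N → Option (ℕ × P.Result)
  /-- `reply t k i m` is the first output for round `t` of machine `k` from node `i` that reaches
  client `m`, with its time of arrival -/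
  reply : ℕ → Fin K → Fin N → Fin M → Option (ℕ × (Fin nY → F))

namespace RunData

variable {P : Scheme F N M K nS nX nY} (r : RunData P)

/-- The signed statements that arrive at node `j` at time `τ`. -/
def inbox (τ : ℕ) (j : Fin N) : Set (Fin N × P.consensus.Content) :=
  {c | ∃ σ i, r.sentArr σ i j = τ ∧ c ∈ r.sent σ i j}

/-- The client requests that arrive at node `j` at time `τ`. -/
def requests (τ : ℕ) (j : Fin N) : Set (Fin K × Request F M nX) :=
  {q | r.submit q.2.stamp q.2.client q.1 = some q.2.cmd ∧
    r.submitArr q.2.stamp q.2.client q.1 j = τ}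

/-- At time `τ` node `i` has decided on the input commands `x` for round `t`. -/
def Decides (i : Fin N) (τ t : ℕ) (x : Fin K → Request F M nX) : Prop :=
  P.consensus.decided i (r.st τ i) t = some x

/-- Time `τ` is the first one at which node `i` is ready for round `t` (it has finished the
earlier rounds and has decided on the commands), and its local result is `g`. -/
def Computes (i : Fin N) (τ t : ℕ) (g : P.Result) : Prop :=
  r.round τ i = t ∧
  (∃ x, r.Decides i τ t x ∧ g = P.compute t i (r.store τ i) (fun k => (x k).cmd)) ∧
  ∀ σ < τ, ¬ (r.round σ i = t ∧ ∃ x, r.Decides i σ t x)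

/-- At time `τ` node `i` completes round `t`, with input commands `x`, by recovering the estimates
`e` of next states and outputs from the local results it has by then. -/
def Completes (i : Fin N) (τ t : ℕ) (x : Fin K → Request F M nX)
    (e : ↥(P.covers t i) → (Fin nS → F) × (Fin nY → F)) : Prop :=
  r.round τ i = t ∧ r.Decides i τ t x ∧
  P.decode t i (fun j => arrivedBy τ (r.result t j i)) = some e

/-- By time `τ` client `m` decides on `y` as the output of round `t` of machine `k`. -/
def ClientDecides (m : Fin M) (τ t : ℕ) (k : Fin K) (y : Fin nY → F) : Prop :=
  P.clientDecide t k (fun i => arrivedBy τ (r.reply t k i m)) = some y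

/-- The time `a` is a legal arrival time for a message sent at time `τ` between honest parties of
a partially synchronous network: the delay is unbounded before the global stabilization time and at
most `Δ` from then on. -/
def Timely (Δ τ a : ℕ) : Prop := τ < a ∧ a ≤ max τ r.gst + Δ

/-- `r` is a possible run of `P` in which exactly the nodes outside `B` are guaranteed to follow the
protocol, on a partially synchronous network with delay bound `Δ` after stabilization. The nodes in
`B` are subject to authenticated Byzantine faults: they send whatever they want (or nothing), to
whomever they want, whenever they want, but cannot sign in the name of an honest node. -/
structure IsRun (Δ : ℕ) (B : Finset (Fin N)) : Prop where
  /-- clients keep submitting commands to every machine -/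
  submit_often : ∀ k τ, ∃ τ' m, τ ≤ τ' ∧ (r.submit τ' m k).isSome
  submit_timely : ∀ τ m k, ∀ i ∉ B, r.Timely Δ τ (r.submitArr τ m k i)
  sent_later : ∀ τ i j, τ < r.sentArr τ i j
  sent_timely : ∀ τ, ∀ i ∉ B, ∀ j ∉ B, r.Timely Δ τ (r.sentArr τ i j)
  /-- honest nodes send what the protocol prescribes, as far as it consists of statements that they
  sign themselves and of signed statements that they have received before -/
  sent_honest : ∀ τ, ∀ i ∉ B, ∀ j, r.sent τ i j =
    {c | c ∈ P.consensus.send i (r.st τ i) j ∧ (c.1 = i ∨ ∃ σ < τ, c ∈ r.inbox σ i)}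
  /-- faulty nodes can send, besides statements signed by faulty nodes, only such statements signed
  by an honest node as this node has already sent to somebody -/
  sent_faulty : ∀ τ, ∀ i ∈ B, ∀ j, ∀ c ∈ r.sent τ i j,
    c.1 ∈ B ∨ ∃ σ ≤ τ, ∃ l, c ∈ r.sent σ c.1 l
  st_zero : ∀ i ∉ B, r.st 0 i = P.consensus.start i
  st_succ : ∀ τ, ∀ i ∉ B,
    r.st (τ + 1) i = P.consensus.step i (r.st τ i) (r.inbox τ i) (r.requests τ i)
  round_zero : ∀ i ∉ B, r.round 0 i = 0
  store_zero : ∀ i ∉ B, r.store 0 i = P.encode 0 i r.s₀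
  /-- a node that completes a round updates its stored data and proceeds to the next round -/
  complete : ∀ τ, ∀ i ∉ B, ∀ t x e, r.Completes i τ t x e →
    r.round (τ + 1) i = t + 1 ∧
    r.store (τ + 1) i = P.update t i (r.store τ i) (fun k => (e k).1)
  /-- otherwise both stay the same -/
  idle : ∀ τ, ∀ i ∉ B, (¬ ∃ t x e, r.Completes i τ t x e) →
    r.round (τ + 1) i = r.round τ i ∧ r.store (τ + 1) i = r.store τ i
  /-- an honest node has its own local result at once -/
  result_self : ∀ i ∉ B, ∀ τ t g, r.Computes i τ t g → r.result t i i = some (τ, g)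
  /-- an honest node multicasts its local result -/
  result_other : ∀ i ∉ B, ∀ τ t g, r.Computes i τ t g → ∀ j ∈ P.dest t i, j ≠ i →
    ∃ a, r.result t i j = some (a, g) ∧ τ < a ∧ (j ∉ B → r.Timely Δ τ a)
  /-- an honest node sends no other results -/
  result_only : ∀ i ∉ B, ∀ t j a g, r.result t i j = some (a, g) →
    (j = i ∨ j ∈ P.dest t i) ∧ ∃ τ, r.Computes i τ t g
  /-- an honest node returns the recovered outputs to the clients who submitted the commands -/
  reply_sent : ∀ i ∉ B, ∀ τ t x e, r.Completes i τ t x e → ∀ k : ↥(P.covers t i),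
    ∃ a, r.reply t k i (x k).client = some (a, (e k).2) ∧ r.Timely Δ τ a
  /-- an honest node sends no other outputs -/
  reply_only : ∀ i ∉ B, ∀ t k m a y, r.reply t k i m = some (a, y) →
    ∃ τ x e, r.Completes i τ t x e ∧ (x k).client = m ∧ ∃ hk : k ∈ P.covers t i, y = (e ⟨k, hk⟩).2

end RunData

/-- The true state `S_k(t)` of machine `k` when it is started in `s₀ k` and fed the commands
`x 0 k, x 1 k, …`, for the transition function `f`. -/
def trueState (f : (Fin nS → F) → (Fin nX → F) → (Fin nS → F) × (Fin nY → F))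
    (s₀ : Fin K → Fin nS → F) (x : ℕ → Fin K → Request F M nX) : ℕ → Fin K → Fin nS → F
  | 0, k => s₀ k
  | t + 1, k => (f (trueState f s₀ x t k) (x t k).cmd).1

/-- The true output `Y_k(t)`. -/
def trueOutput (f : (Fin nS → F) → (Fin nX → F) → (Fin nS → F) × (Fin nY → F))
    (s₀ : Fin K → Fin nS → F) (x : ℕ → Fin K → Request F M nX) (t : ℕ) (k : Fin K) : Fin nY → F :=
  (f (trueState f s₀ x t k) (x t k).cmd).2

/-! ## Security -/

namespace RunData

variable {P : Scheme F N M K nS nX nY} (r : RunData P)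

/-- Validity: a command that an honest node has decided on for machine `k` has indeed been
submitted by a client to machine `k` before. -/
def Validity (B : Finset (Fin N)) : Prop :=
  ∀ i ∉ B, ∀ τ t x, r.Decides i τ t x → ∀ k,
    r.submit (x k).stamp (x k).client k = some (x k).cmd ∧ (x k).stamp < τ

/-- Consistency: honest nodes never decide on different commands for the same round. -/
def Consistency (B : Finset (Fin N)) : Prop :=
  ∀ i ∉ B, ∀ j ∉ B, ∀ τ τ' t x x', r.Decides i τ t x → r.Decides j τ' t x' → x = x'

/-- Correctness: if `x 0, …, x t` are the commands decided on for the rounds up to `t`, then the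
next states recovered by honest nodes in round `t` are the true ones, and so are the outputs on
which the clients who submitted the commands of round `t` decide. -/
def Correctness (B : Finset (Fin N))
    (f : (Fin nS → F) → (Fin nX → F) → (Fin nS → F) × (Fin nY → F)) : Prop :=
  ∀ (x : ℕ → Fin K → Request F M nX) (t : ℕ),
    (∀ t' ≤ t, ∃ i ∉ B, ∃ τ, r.Decides i τ t' (x t')) →
    (∀ i ∉ B, ∀ τ x' e, r.Completes i τ t x' e →
      ∀ k : ↥(P.covers t i), (e k).1 = trueState f r.s₀ x (t + 1) k) ∧
    ∀ k τ y, r.ClientDecides (x t k).client τ t k y → y = trueOutput f r.s₀ x t k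

/-- Liveness: every submitted command is executed: there is a round for which it is selected, which
every honest node completes, and for which the submitting client decides on an output. -/
def Liveness (B : Finset (Fin N)) : Prop :=
  ∀ τ m k c, r.submit τ m k = some c → ∃ t,
    (∀ i ∉ B, ∃ τ' x e, r.Completes i τ' t x e ∧ x k = ⟨m, τ, c⟩) ∧
    ∃ τ' y, r.ClientDecides m τ' t k y

end RunData

namespace Scheme

variable (P : Scheme F N M K nS nX nY)

/-- The scheme is `b`-secure on partially synchronous networks with delay bound `Δ` after
stabilization, for state machines with transition function `f`. -/
def Secure (Δ : ℕ) (f : (Fin nS → F) → (Fin nX → F) → (Fin nS → F) × (Fin nY → F)) (b : ℕ) :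
    Prop :=
  ∀ B : Finset (Fin N), B.card ≤ b → ∀ r : RunData P, r.IsRun Δ B →
    r.Validity B ∧ r.Consistency B ∧ r.Correctness B f ∧ r.Liveness B

open Classical in
/-- Storage efficiency: the size of all `K` states divided by the size of the data stored at a
node, where the size of an element of a finite set `A` is `log |A|`. Over an infinite field sizes
are measured by dimensions (over a finite field this gives the same ratio). -/
noncomputable def storageEfficiency : ℝ :=
  if Finite F then
    K * Real.log (Nat.card (Fin nS → F)) / Real.log (Nat.card (Fin P.storeDim → F))
  else K * nS / P.storeDim

end Scheme

/-- The number of state machines to be supported: `⌊(1 - 3ν) N / d + 1 - 1 / d⌋`. -/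
noncomputable def capacity (ν : ℝ) (d N : ℕ) : ℕ :=
  ⌊(1 - 3 * ν) / d * N + 1 - 1 / d⌋₊

end CodedSM

/-! Put b = ⌊νN⌋. The bound K ≤ `capacity` yields d(K-1) + 3b < N (`degree_bound_of_le_capacity`),
and two counting facts follow. Any two sets of at least N - b nodes share an honest node. Two
different families of polynomials of degree at most d(K-1) cannot both fit N - b available results
with at most b exceptions each (`Explains.unique`).

Execution: states and commands are interpolated through K points, and node i keeps only the value of
the state interpolant at α i, which has the size of one state. A polynomial transition function
commutes with evaluation, so the local results are values of polynomials of degree at most d(K-1),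
which take the true next states and outputs at the K points. Uniqueness lets a node decode although
b results may be missing and b others false; `SelectedRun.storeCorrect` carries this through time. A
client trusts an output reported by more than b nodes.

Consensus: leaders rotate through views with three phases of length Δ + 1. Safety is
`CommitQuorum.eq_of_voteQuorum`: a commitment locks its value, and a locked node votes only for a
value with a vote quorum at least as recent as its locks. Liveness is `decided_of_honest_leader`:
after stabilization an honest leader knows every quorum behind an honest lock and sees the same
pending requests as its voters. Serving requests in the order of their keys then excludes starvation
(`exists_selected`).

Optimality: if b + 1 nodes are silent, no quorum of N - b signatures ever forms, so nothing is
executed (`le_of_secure_codedScheme`). -/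

namespace CodedSM

section consensus

/-! ## A view-based quorum protocol for the consensus phase -/

/-- The statements exchanged in the consensus phase: proposals, votes and commitments, for a round,
a view, and a value. -/
inductive Ballot (V : Type u) : Type u
  | propose (t v : ℕ) (x : V)
  | vote (t v : ℕ) (x : V)
  | commit (t v : ℕ) (x : V)

/-- The vectors of requests on which the nodes have to agree in every round. -/
abbrev Batch (F : Type u) (M K nX : ℕ) : Type u := Fin K → Request F M nX

/-- A number that determines the time stamp and the client of a request; requests are served in the
order of these numbers. -/
def Request.key {F : Type u} {M nX : ℕ} (ρ : Request F M nX) : ℕ := ρ.stamp * M + ρ.client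

/-- The client index is below `M`, so stamp and client are quotient and remainder of the key modulo
`M`. -/
theorem Request.stamp_client_eq_of_key_eq {F : Type u} {M nX : ℕ} {ρ ρ' : Request F M nX}
    (h : ρ.key = ρ'.key) : ρ.stamp = ρ'.stamp ∧ ρ.client = ρ'.client := by
  have hM : 0 < M := ρ.client.pos
  have h1 : ∀ σ : Request F M nX, σ.key / M = σ.stamp ∧ σ.key % M = σ.client := by
    intro σ
    constructor
    · rw [Request.key, Nat.add_comm, Nat.add_mul_div_right _ _ hM, Nat.div_eq_of_lt σ.client.2,
        Nat.zero_add]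
    · rw [Request.key, Nat.add_comm, Nat.add_mul_mod_self_right, Nat.mod_eq_of_lt σ.client.2]
  exact ⟨by rw [← (h1 ρ).1, ← (h1 ρ').1, h], Fin.ext (by rw [← (h1 ρ).2, ← (h1 ρ').2, h])⟩

/-- The state of a node: the local clock, the signed statements and the client requests received so
far, and the triples (round, view, value) to which the node has committed. -/
structure NodeState (F : Type u) (N M K nX : ℕ) : Type u where
  clock : ℕ
  known : Set (Fin N × Ballot (Batch F M K nX))
  reqs : Set (Fin K × Request F M nX)
  locks : Set (ℕ × ℕ × Batch F M K nX)

/-! ### Choice of witnesses, quorums and view times -/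

open Classical in
/-- Some element with the property `p`, if there is one. -/
noncomputable def pick {α : Type u} (p : α → Prop) : Option α :=
  if h : ∃ x, p x then some h.choose else none

theorem pick_spec {α : Type u} {p : α → Prop} {x : α} (h : pick p = some x) : p x := by
  unfold pick at h
  split_ifs at h with hp
  exact Option.some.inj h ▸ hp.choose_spec

theorem exists_pick_eq_some {α : Type u} {p : α → Prop} (h : ∃ x, p x) : ∃ x, pick p = some x :=
  ⟨h.choose, dif_pos h⟩

/-- Uniqueness makes an arbitrary choice predictable; this is how separate nodes are shown to choose
alike. -/
theorem pick_eq_some {α : Type u} {p : α → Prop} {x : α} (hx : p x) (hu : ∀ y, p y → y = x) :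
    pick p = some x := by
  obtain ⟨y, hy⟩ := exists_pick_eq_some ⟨x, hx⟩
  rw [hy, hu y (pick_spec hy)]

variable {F : Type u} {N M K nX : ℕ}

/-- At least `N - b` nodes have signed `c` in `S`. -/
def Quorum {V : Type u} (b : ℕ) (S : Set (Fin N × Ballot V)) (c : Ballot V) : Prop :=
  ∃ Q : Finset (Fin N), N ≤ Q.card + b ∧ ∀ j ∈ Q, (j, c) ∈ S

theorem Quorum.mono {V : Type u} {b : ℕ} {S S' : Set (Fin N × Ballot V)} {c : Ballot V}
    (h : Quorum b S c) (hS : S ⊆ S') : Quorum b S' c := by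
  obtain ⟨Q, hQ, hc⟩ := h
  exact ⟨Q, hQ, fun j hj => hS (hc j hj)⟩

/-- The time at which view `v` starts, if each of its three phases takes `L` units of time. -/
def viewStart (L v : ℕ) : ℕ := 3 * L * v

theorem viewStart_succ (L v : ℕ) : viewStart L (v + 1) = viewStart L v + 3 * L := by
  simp only [viewStart]; ring

theorem viewStart_mono {L v w : ℕ} (h : v ≤ w) : viewStart L v ≤ viewStart L w :=
  Nat.mul_le_mul_left _ h

theorem viewStart_add_le {L v w : ℕ} (h : v < w) : viewStart L v + 3 * L ≤ viewStart L w := by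
  rw [← viewStart_succ]; exact viewStart_mono h

theorem le_viewStart {L v : ℕ} (hL : 0 < L) : v ≤ viewStart L v :=
  Nat.le_mul_of_pos_left _ (by omega)

/-! ### Rules of the protocol -/

namespace NodeState

variable (b L : ℕ) (q : NodeState F N M K nX)

/-- The value decided for round `t`: one to which a quorum has committed in the same view. -/
noncomputable def decided (t : ℕ) : Option (Batch F M K nX) :=
  pick fun x => ∃ v, Quorum b q.known (.commit t v x)

/-- The requests for machine `k` that can be selected for round `t` in view `v`: those which are
sufficiently old and have not been selected for an earlier round. -/
def Pending (t v : ℕ) (k : Fin K) : Set (Request F M nX) :=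
  {ρ | (k, ρ) ∈ q.reqs ∧ ρ.stamp + L ≤ viewStart L v ∧
    ∀ s < t, ∀ y, q.decided b s = some y → y k ≠ ρ}

/-- A fresh value for round `t` in view `v`: all earlier rounds are decided, and the value consists
of the first pending request for every machine. -/
def Fresh (t v : ℕ) (x : Batch F M K nX) : Prop :=
  t ≤ v ∧ (∀ s < t, ∃ y, q.decided b s = some y) ∧
    ∀ k, x k ∈ q.Pending b L t v k ∧ ∀ ρ ∈ q.Pending b L t v k, (x k).key ≤ ρ.key

/-- What a leader may propose: the value of the latest quorum of votes, or a fresh value if there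
has been no quorum. -/
def Proposable (t v : ℕ) (x : Batch F M K nX) : Prop :=
  (∃ w < v, Quorum b q.known (.vote t w x) ∧
    ∀ w' < v, ∀ y, Quorum b q.known (.vote t w' y) → w' ≤ w) ∨
  ((∀ w < v, ∀ y, ¬ Quorum b q.known (.vote t w y)) ∧ q.Fresh b L t v x)

/-- What a node may vote for: a value proposed by the leader of the view that had a quorum of votes
no earlier than any value locked by the node, or is fresh if the node has no locked value. -/
def Acceptable (t v : ℕ) (x : Batch F M K nX) : Prop :=
  (∃ l : Fin N, (l : ℕ) = v % N ∧ (l, Ballot.propose t v x) ∈ q.known) ∧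
  ((∃ w < v, Quorum b q.known (.vote t w x) ∧ ∀ w' y, (t, w', y) ∈ q.locks → w' ≤ w) ∨
   ((∀ w' y, (t, w', y) ∉ q.locks) ∧ q.Fresh b L t v x))

/-- The statements that node `i` has to sign in a given state. -/
def Issues (i : Fin N) : Ballot (Batch F M K nX) → Prop
  | .propose t v x => (i : ℕ) = v % N ∧ q.clock = viewStart L v ∧
      pick (q.Proposable b L t v) = some x
  | .vote t v x => q.clock = viewStart L v + L ∧ pick (q.Acceptable b L t v) = some x
  | .commit t v x => q.clock = viewStart L v + 2 * L ∧ Quorum b q.known (.vote t v x)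

/-- The next state. -/
def next (inbox : Set (Fin N × Ballot (Batch F M K nX))) (rq : Set (Fin K × Request F M nX)) :
    NodeState F N M K nX where
  clock := q.clock + 1
  known := q.known ∪ inbox
  reqs := q.reqs ∪ rq
  locks := q.locks ∪
    {l | q.clock = viewStart L l.2.1 + 2 * L ∧ Quorum b q.known (.vote l.1 l.2.1 l.2.2)}

/-- The statements sent in a given state: those which the node has to sign, and all the statements
received so far. -/
def sends (i : Fin N) : Set (Fin N × Ballot (Batch F M K nX)) :=
  {c | c.1 = i ∧ q.Issues b L i c.2} ∪ q.known

end NodeState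

/-- The view-based quorum protocol, as a consensus protocol. -/
noncomputable def quorumConsensus (F : Type u) (N M K nX b L : ℕ) : Consensus F N M K nX where
  State := NodeState F N M K nX
  Content := Ballot (Batch F M K nX)
  start _ := ⟨0, ∅, ∅, ∅⟩
  step _ q inbox rq := q.next b L inbox rq
  send i q _ := q.sends b L i
  decided _ q t := q.decided b t

/-- The consensus phase of a run of the quorum protocol over a partially synchronous network, with
the set `B` of faulty nodes. -/
structure Execution (F : Type u) (N M K nX b Δ : ℕ) (B : Finset (Fin N)) where
  gst : ℕ
  submit : ℕ → Fin M → Fin K → Option (Fin nX → F)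
  submitArr : ℕ → Fin M → Fin K → Fin N → ℕ
  sent : ℕ → Fin N → Fin N → Set (Fin N × Ballot (Batch F M K nX))
  sentArr : ℕ → Fin N → Fin N → ℕ
  st : ℕ → Fin N → NodeState F N M K nX
  submit_often : ∀ k τ, ∃ τ' m, τ ≤ τ' ∧ (submit τ' m k).isSome
  submit_timely : ∀ τ m k, ∀ i ∉ B, τ < submitArr τ m k i ∧ submitArr τ m k i ≤ max τ gst + Δ
  sent_later : ∀ τ i j, τ < sentArr τ i j
  sent_timely : ∀ τ, ∀ i ∉ B, ∀ j ∉ B, sentArr τ i j ≤ max τ gst + Δ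
  sent_honest : ∀ τ, ∀ i ∉ B, ∀ j, sent τ i j =
    {c | c ∈ (st τ i).sends b (Δ + 1) i ∧
      (c.1 = i ∨ ∃ σ < τ, ∃ σ' i', sentArr σ' i' i = σ ∧ c ∈ sent σ' i' i)}
  sent_faulty : ∀ τ, ∀ i ∈ B, ∀ j, ∀ c ∈ sent τ i j, c.1 ∈ B ∨ ∃ σ ≤ τ, ∃ l, c ∈ sent σ c.1 l
  st_zero : ∀ i ∉ B, st 0 i = ⟨0, ∅, ∅, ∅⟩
  st_succ : ∀ τ, ∀ i ∉ B, st (τ + 1) i =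
    (st τ i).next b (Δ + 1) {c | ∃ σ i', sentArr σ i' i = τ ∧ c ∈ sent σ i' i}
      {q | submit q.2.stamp q.2.client q.1 = some q.2.cmd ∧
        submitArr q.2.stamp q.2.client q.1 i = τ}

namespace Execution

variable {b Δ : ℕ} {B : Finset (Fin N)} (r : Execution F N M K nX b Δ B)

/-! ### Local states -/

theorem clock_eq {i : Fin N} (hi : i ∉ B) (τ : ℕ) : (r.st τ i).clock = τ := by
  induction τ with
  | zero => rw [r.st_zero i hi]
  | succ τ ih => rw [r.st_succ τ i hi, NodeState.next, ih]

theorem mem_known_iff {i : Fin N} (hi : i ∉ B) (τ : ℕ) (c : Fin N × Ballot (Batch F M K nX)) :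
    c ∈ (r.st τ i).known ↔ ∃ σ < τ, ∃ σ' i', r.sentArr σ' i' i = σ ∧ c ∈ r.sent σ' i' i := by
  induction τ with
  | zero => rw [r.st_zero i hi]; simp
  | succ τ ih =>
    rw [r.st_succ τ i hi]
    simp only [NodeState.next, Set.mem_union, ih, Set.mem_ofPred_eq]
    constructor
    · rintro (⟨σ, h, h'⟩ | h)
      · exact ⟨σ, by omega, h'⟩
      · exact ⟨τ, by omega, h⟩
    · rintro ⟨σ, h, h'⟩
      rcases Nat.lt_succ_iff_lt_or_eq.1 h with h | rfl
      · exact Or.inl ⟨σ, h, h'⟩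
      · exact Or.inr h'

theorem known_mono {i : Fin N} (hi : i ∉ B) {τ τ' : ℕ} (h : τ ≤ τ') :
    (r.st τ i).known ⊆ (r.st τ' i).known := by
  intro c hc
  rw [r.mem_known_iff hi] at hc ⊢
  obtain ⟨σ, hσ, hc⟩ := hc
  exact ⟨σ, by omega, hc⟩

/-- The request `ρ` has been submitted to machine `k`. -/
def Submitted (k : Fin K) (ρ : Request F M nX) : Prop :=
  r.submit ρ.stamp ρ.client k = some ρ.cmd

theorem mem_reqs_iff {i : Fin N} (hi : i ∉ B) (τ : ℕ) (q : Fin K × Request F M nX) :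
    q ∈ (r.st τ i).reqs ↔
      r.Submitted q.1 q.2 ∧ r.submitArr q.2.stamp q.2.client q.1 i < τ := by
  induction τ with
  | zero => rw [r.st_zero i hi]; simp
  | succ τ ih =>
    rw [r.st_succ τ i hi]
    simp only [NodeState.next, Set.mem_union, ih, Set.mem_ofPred_eq, Submitted]
    rw [← and_or_left, Nat.lt_succ_iff_lt_or_eq]

/-- Clocks show the global time, so a lock for view `w` can arise at one instant only, the start of
the third phase of `w`, and is never dropped. -/
theorem mem_locks_iff {i : Fin N} (hi : i ∉ B) (τ t w : ℕ) (x : Batch F M K nX) :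
    (t, w, x) ∈ (r.st τ i).locks ↔ viewStart (Δ + 1) w + 2 * (Δ + 1) < τ ∧
      Quorum b (r.st (viewStart (Δ + 1) w + 2 * (Δ + 1)) i).known (.vote t w x) := by
  induction τ with
  | zero => rw [r.st_zero i hi]; simp
  | succ τ ih =>
    rw [r.st_succ τ i hi]
    simp only [NodeState.next, Set.mem_union, ih, Set.mem_ofPred_eq, r.clock_eq hi]
    rw [Nat.lt_succ_iff_lt_or_eq]
    constructor
    · rintro (h | ⟨h, h'⟩)
      · exact ⟨Or.inl h.1, h.2⟩
      · exact ⟨Or.inr h.symm, h ▸ h'⟩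
    · rintro ⟨h | h, h'⟩
      · exact Or.inl ⟨h, h'⟩
      · exact Or.inr ⟨h.symm, h ▸ h'⟩

/-! ### Communication -/

/-- The protocol emits only own and already received statements, so the network's restriction on
honest senders removes nothing. -/
theorem sent_eq {i : Fin N} (hi : i ∉ B) (τ : ℕ) (j : Fin N) :
    r.sent τ i j = (r.st τ i).sends b (Δ + 1) i := by
  rw [r.sent_honest τ i hi j]
  ext c
  simp only [Set.mem_ofPred_eq, ← r.mem_known_iff hi]
  constructor
  · exact fun h => h.1
  · intro h
    refine ⟨h, ?_⟩
    rcases h with h | h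
    · exact Or.inl h.1
    · exact Or.inr h

/-- The delay is at most `Δ`, and one more step moves the inbox into `known`; this is why a phase
lasts `Δ + 1`. -/
theorem mem_known_of_sent {i j : Fin N} (hi : i ∉ B) (hj : j ∉ B) {τ τ' : ℕ}
    (h : max τ r.gst + (Δ + 1) ≤ τ') {c : Fin N × Ballot (Batch F M K nX)}
    (hc : c ∈ (r.st τ i).sends b (Δ + 1) i) : c ∈ (r.st τ' j).known := by
  rw [r.mem_known_iff hj]
  have := r.sent_timely τ i hi j hj
  exact ⟨_, by omega, τ, i, rfl, by rwa [r.sent_eq hi]⟩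

theorem known_subset {i j : Fin N} (hi : i ∉ B) (hj : j ∉ B) {τ τ' : ℕ}
    (h : max τ r.gst + (Δ + 1) ≤ τ') : (r.st τ i).known ⊆ (r.st τ' j).known :=
  fun _ hc => r.mem_known_of_sent hi hj h (Or.inr hc)

/-- Signatures of honest nodes cannot be forged. -/
theorem issues_of_sent (τ : ℕ) : ∀ i j (c : Fin N × Ballot (Batch F M K nX)),
    c ∈ r.sent τ i j → c.1 ∉ B → ∃ σ ≤ τ, (r.st σ c.1).Issues b (Δ + 1) c.1 c.2 := by
  induction τ using Nat.strong_induction_on with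
  | _ τ ih =>
  -- Honest senders come first because a faulty node may copy what an honest signer sends at the
  -- very same time, where the induction hypothesis is silent.
  have honest : ∀ i j (c : Fin N × Ballot (Batch F M K nX)), i ∉ B →
      c ∈ r.sent τ i j → c.1 ∉ B → ∃ σ ≤ τ, (r.st σ c.1).Issues b (Δ + 1) c.1 c.2 := by
    intro i j c hi hc hB
    rw [r.sent_eq hi] at hc
    rcases hc with ⟨h, hc⟩ | hc
    · subst h
      exact ⟨τ, le_rfl, hc⟩
    · rw [r.mem_known_iff hi] at hc
      obtain ⟨σ, hσ, σ', i', h, hc⟩ := hc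
      have := r.sent_later σ' i' i
      obtain ⟨σ'', h', hc⟩ := ih σ' (by omega) i' i c hc hB
      exact ⟨σ'', by omega, hc⟩
  intro i j c hc hB
  by_cases hi : i ∈ B
  · obtain h | ⟨σ, hσ, l, h⟩ := r.sent_faulty τ i hi j c hc
    · exact absurd h hB
    · rcases hσ.lt_or_eq with hσ | rfl
      · obtain ⟨σ', h', hc⟩ := ih σ hσ _ _ c h hB
        exact ⟨σ', by omega, hc⟩
      · exact honest _ _ c hB h hB
  · exact honest i j c hi hc hB

theorem issues_of_known {i : Fin N} (hi : i ∉ B) {τ : ℕ} {j : Fin N} (hj : j ∉ B)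
    {c : Ballot (Batch F M K nX)} (h : (j, c) ∈ (r.st τ i).known) :
    ∃ σ < τ, (r.st σ j).Issues b (Δ + 1) j c := by
  rw [r.mem_known_iff hi] at h
  obtain ⟨σ, hσ, σ', i', h, hc⟩ := h
  have := r.sent_later σ' i' i
  obtain ⟨σ'', h', hc⟩ := r.issues_of_sent σ' i' i _ hc hj
  exact ⟨σ'', by omega, hc⟩

/-! ### Safety -/

/-- Honest node `j` votes for `x` in view `v` of round `t`. -/
def Votes (j : Fin N) (t v : ℕ) (x : Batch F M K nX) : Prop :=
  pick ((r.st (viewStart (Δ + 1) v + (Δ + 1)) j).Acceptable b (Δ + 1) t v) = some x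

/-- Honest node `j` commits to `x` in view `v` of round `t`. -/
def Commits (j : Fin N) (t v : ℕ) (x : Batch F M K nX) : Prop :=
  Quorum b (r.st (viewStart (Δ + 1) v + 2 * (Δ + 1)) j).known (.vote t v x)

/-- The honest nodes of some quorum have voted for `x` in view `v` of round `t`. -/
def VoteQuorum (t v : ℕ) (x : Batch F M K nX) : Prop :=
  ∃ Q : Finset (Fin N), N ≤ Q.card + b ∧ ∀ j ∈ Q, j ∉ B → r.Votes j t v x

/-- The honest nodes of some quorum have committed to `x` in view `v` of round `t`. -/
def CommitQuorum (t v : ℕ) (x : Batch F M K nX) : Prop :=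
  ∃ Q : Finset (Fin N), N ≤ Q.card + b ∧ ∀ j ∈ Q, j ∉ B → r.Commits j t v x

/-- An unforgeable vote was issued when the signer's clock read the voting time of `v`. This fixes
the state in which it was cast and makes the vote independent of who has seen it. -/
theorem voteQuorum_of_known {i : Fin N} (hi : i ∉ B) {τ t v : ℕ} {x : Batch F M K nX}
    (h : Quorum b (r.st τ i).known (.vote t v x)) : r.VoteQuorum t v x := by
  obtain ⟨Q, hQ, h⟩ := h
  refine ⟨Q, hQ, fun j hj hB => ?_⟩
  obtain ⟨σ, -, h1, h2⟩ := r.issues_of_known hi hB (h j hj)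
  rw [r.clock_eq hB] at h1
  rwa [h1] at h2

theorem commitQuorum_of_known {i : Fin N} (hi : i ∉ B) {τ t v : ℕ} {x : Batch F M K nX}
    (h : Quorum b (r.st τ i).known (.commit t v x)) : r.CommitQuorum t v x := by
  obtain ⟨Q, hQ, h⟩ := h
  refine ⟨Q, hQ, fun j hj hB => ?_⟩
  obtain ⟨σ, -, h1, h2⟩ := r.issues_of_known hi hB (h j hj)
  rw [r.clock_eq hB] at h1
  rwa [h1] at h2

/-- The intersection has at least N - 2b > b elements, too many to be all faulty. -/
theorem exists_honest_mem_inter (hB : B.card ≤ b) (hN : 3 * b < N) {Q Q' : Finset (Fin N)}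
    (hQ : N ≤ Q.card + b) (hQ' : N ≤ Q'.card + b) : ∃ j ∈ Q, j ∈ Q' ∧ j ∉ B := by
  by_contra! h
  have h1 : Q ∩ Q' ⊆ B := fun j hj => h j (Finset.mem_inter.1 hj).1 (Finset.mem_inter.1 hj).2
  have h2 := Finset.card_le_card h1
  have h3 := Finset.card_union_add_card_inter Q Q'
  have h4 := (Q ∪ Q').card_le_univ
  rw [Fintype.card_fin] at h4
  omega

variable {r}

/-- A common honest voter casts a single vote per round and view, because `pick` returns one value.
-/
theorem VoteQuorum.unique (hB : B.card ≤ b) (hN : 3 * b < N) {t v : ℕ} {x y : Batch F M K nX}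
    (hx : r.VoteQuorum t v x) (hy : r.VoteQuorum t v y) : x = y := by
  obtain ⟨Q, hQ, hx⟩ := hx
  obtain ⟨Q', hQ', hy⟩ := hy
  obtain ⟨j, hj, hj', hjB⟩ := exists_honest_mem_inter hB hN hQ hQ'
  exact Option.some.inj ((hx j hj hjB).symm.trans (hy j hj' hjB))

theorem CommitQuorum.voteQuorum (hB : B.card ≤ b) (hN : 3 * b < N) {t v : ℕ}
    {x : Batch F M K nX} (h : r.CommitQuorum t v x) : r.VoteQuorum t v x := by
  obtain ⟨Q, hQ, h⟩ := h
  -- Intersecting a quorum with itself yields an honest member.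
  obtain ⟨j, hj, -, hjB⟩ := exists_honest_mem_inter hB hN hQ hQ
  exact r.voteQuorum_of_known hjB (h j hj hjB)

/-- Once a quorum has committed to a value, no other value gets a quorum of votes. -/
theorem CommitQuorum.eq_of_voteQuorum (hB : B.card ≤ b) (hN : 3 * b < N) {t v : ℕ}
    {x : Batch F M K nX} (h : r.CommitQuorum t v x) (w : ℕ) :
    v ≤ w → ∀ y, r.VoteQuorum t w y → y = x := by
  induction w using Nat.strong_induction_on with
  | _ w ih =>
  intro hw y hy
  rcases hw.lt_or_eq with hlt | rfl
  · obtain ⟨Q, hQ, hx⟩ := id h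
    obtain ⟨Q', hQ', hy⟩ := hy
    obtain ⟨j, hj, hj', hjB⟩ := exists_honest_mem_inter hB hN hQ hQ'
    -- The common node `j` committed in view `v` before voting in view `w`. Its vote thus needs an
    -- earlier vote quorum in some view `w'` with v ≤ w' < w, to which induction applies.
    have hlock : (t, v, x) ∈ (r.st (viewStart (Δ + 1) w + (Δ + 1)) j).locks := by
      rw [r.mem_locks_iff hjB]
      have := viewStart_add_le (L := Δ + 1) hlt
      exact ⟨by omega, hx j hj hjB⟩
    rcases (pick_spec (hy j hj' hjB)).2 with ⟨w', hw', hq, hl⟩ | ⟨hl, -⟩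
    · exact ih w' hw' (hl _ _ hlock) y (r.voteQuorum_of_known hjB hq)
    · exact absurd hlock (hl _ _)
  · exact hy.unique hB hN (h.voteQuorum hB hN)

theorem CommitQuorum.unique (hB : B.card ≤ b) (hN : 3 * b < N) {t v w : ℕ}
    {x y : Batch F M K nX} (hx : r.CommitQuorum t v x) (hy : r.CommitQuorum t w y) : x = y := by
  rcases le_total v w with h | h
  · exact (hx.eq_of_voteQuorum hB hN w h y (hy.voteQuorum hB hN)).symm
  · exact hy.eq_of_voteQuorum hB hN v h x (hx.voteQuorum hB hN)

/-- A value with a quorum of votes has been fresh for some honest voter. -/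
theorem VoteQuorum.exists_fresh (hB : B.card ≤ b) (hN : 3 * b < N) {t : ℕ} {x : Batch F M K nX}
    (v : ℕ) : r.VoteQuorum t v x → ∃ j ∉ B, ∃ w ≤ v,
      (r.st (viewStart (Δ + 1) w + (Δ + 1)) j).Fresh b (Δ + 1) t w x := by
  induction v using Nat.strong_induction_on with
  | _ v ih =>
  rintro ⟨Q, hQ, h⟩
  obtain ⟨j, hj, -, hjB⟩ := exists_honest_mem_inter hB hN hQ hQ
  rcases (pick_spec (h j hj hjB)).2 with ⟨w, hw, hq, -⟩ | ⟨-, hf⟩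
  · obtain ⟨j', hj', w', hw', hf⟩ := ih w hw (r.voteQuorum_of_known hjB hq)
    exact ⟨j', hj', w', by omega, hf⟩
  · exact ⟨j, hjB, v, le_rfl, hf⟩

variable (r)

theorem commitQuorum_of_decided {i : Fin N} (hi : i ∉ B) {τ t : ℕ} {x : Batch F M K nX}
    (h : (r.st τ i).decided b t = some x) : ∃ v, r.CommitQuorum t v x := by
  obtain ⟨v, hv⟩ := pick_spec h
  exact ⟨v, r.commitQuorum_of_known hi hv⟩

theorem decided_unique (hB : B.card ≤ b) (hN : 3 * b < N) {i j : Fin N} (hi : i ∉ B)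
    (hj : j ∉ B) {τ τ' t : ℕ} {x y : Batch F M K nX} (hx : (r.st τ i).decided b t = some x)
    (hy : (r.st τ' j).decided b t = some y) : x = y := by
  obtain ⟨v, hv⟩ := r.commitQuorum_of_decided hi hx
  obtain ⟨w, hw⟩ := r.commitQuorum_of_decided hj hy
  exact hv.unique hB hN hw

/-- The decision is re-chosen as `known` grows; only the uniqueness of committed values keeps it
stable. -/
theorem decided_mono (hB : B.card ≤ b) (hN : 3 * b < N) {i : Fin N} (hi : i ∉ B)
    {τ τ' t : ℕ} (h : τ ≤ τ') {x : Batch F M K nX} (hx : (r.st τ i).decided b t = some x) :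
    (r.st τ' i).decided b t = some x := by
  obtain ⟨v, hv⟩ := pick_spec hx
  obtain ⟨y, hy⟩ := exists_pick_eq_some
    (p := fun x => ∃ v, Quorum b (r.st τ' i).known (.commit t v x))
    ⟨x, v, hv.mono (r.known_mono hi h)⟩
  rw [r.decided_unique hB hN hi hi hx hy]
  exact hy

/-- A decided value has been fresh for some honest voter, at an earlier time. -/
theorem exists_fresh_of_decided (hB : B.card ≤ b) (hN : 3 * b < N) {i : Fin N} (hi : i ∉ B)
    {τ t : ℕ} {x : Batch F M K nX} (h : (r.st τ i).decided b t = some x) :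
    ∃ j ∉ B, ∃ w, viewStart (Δ + 1) w + (Δ + 1) < τ ∧
      (r.st (viewStart (Δ + 1) w + (Δ + 1)) j).Fresh b (Δ + 1) t w x := by
  obtain ⟨v, hv⟩ := pick_spec h
  obtain ⟨j, hj, w, hw, hf⟩ :=
    ((r.commitQuorum_of_known hi hv).voteQuorum hB hN).exists_fresh hB hN v
  refine ⟨j, hj, w, ?_, hf⟩
  obtain ⟨Q, hQ, hc⟩ := hv
  obtain ⟨l, hl, -, hlB⟩ := exists_honest_mem_inter hB hN hQ hQ
  obtain ⟨σ, hσ, h1, -⟩ := r.issues_of_known hi hlB (hc l hl)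
  rw [r.clock_eq hlB] at h1
  have := viewStart_mono (L := Δ + 1) hw
  omega

/-- Decided commands have been submitted before. -/
theorem submitted_of_decided (hB : B.card ≤ b) (hN : 3 * b < N) {i : Fin N} (hi : i ∉ B)
    {τ t : ℕ} {x : Batch F M K nX} (h : (r.st τ i).decided b t = some x) (k : Fin K) :
    r.Submitted k (x k) ∧ (x k).stamp < τ := by
  obtain ⟨j, hj, w, hw, -, -, hf⟩ := r.exists_fresh_of_decided hB hN hi h
  obtain ⟨h1, h2, -⟩ := (hf k).1
  exact ⟨((r.mem_reqs_iff hj _ _).1 h1).1, by omega⟩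

/-! ### Liveness -/

theorem mem_reqs_of_submitted {i : Fin N} (hi : i ∉ B) {τ : ℕ} {k : Fin K} {ρ : Request F M nX}
    (h : r.Submitted k ρ) (hg : r.gst + (Δ + 1) ≤ τ) (hs : ρ.stamp + (Δ + 1) ≤ τ) :
    (k, ρ) ∈ (r.st τ i).reqs := by
  rw [r.mem_reqs_iff hi]
  have := (r.submit_timely ρ.stamp ρ.client k i hi).2
  refine ⟨h, ?_⟩
  simp only
  omega

/-- After stabilization all the honest nodes that know the earlier decisions agree on the pending
requests. -/
theorem pending_eq {i : Fin N} (hi : i ∉ B) {τ t v : ℕ} {y : ℕ → Batch F M K nX}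
    (hy : ∀ s < t, (r.st τ i).decided b s = some (y s)) (hg : r.gst + (Δ + 1) ≤ τ)
    (hτ : viewStart (Δ + 1) v ≤ τ) (k : Fin K) :
    (r.st τ i).Pending b (Δ + 1) t v k =
      {ρ | r.Submitted k ρ ∧ ρ.stamp + (Δ + 1) ≤ viewStart (Δ + 1) v ∧ ∀ s < t, y s k ≠ ρ} := by
  ext ρ
  simp only [NodeState.Pending, Set.mem_ofPred_eq]
  constructor
  · rintro ⟨h1, h2, h3⟩
    exact ⟨((r.mem_reqs_iff hi _ _).1 h1).1, h2, fun s hs => h3 s hs _ (hy s hs)⟩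
  · rintro ⟨h1, h2, h3⟩
    -- The age condition guarantees that the request has arrived at every honest node by the start
    -- of the view.
    refine ⟨r.mem_reqs_of_submitted hi h1 hg (by omega), h2, fun s hs z hz => ?_⟩
    rw [hy s hs] at hz
    exact Option.some.inj hz ▸ h3 s hs

/-- Submissions never stop, so some request has a later stamp than all of the finitely many excluded
ones. -/
theorem exists_submitted_ne (k : Fin K) (t : ℕ) (y : ℕ → Batch F M K nX) :
    ∃ ρ, r.Submitted k ρ ∧ ∀ s < t, y s k ≠ ρ := by
  obtain ⟨τ, m, hτ, h⟩ := r.submit_often k ((Finset.range t).sup (fun s => (y s k).stamp) + 1)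
  obtain ⟨c, hc⟩ := Option.isSome_iff_exists.1 h
  refine ⟨⟨m, τ, c⟩, hc, fun s hs he => ?_⟩
  have h1 := Finset.le_sup (f := fun s => (y s k).stamp) (Finset.mem_range.2 hs)
  simp only [he] at h1
  omega

theorem exists_fresh {i : Fin N} (hi : i ∉ B) {τ t v : ℕ} {y : ℕ → Batch F M K nX}
    (hy : ∀ s < t, (r.st τ i).decided b s = some (y s)) (hg : r.gst + (Δ + 1) ≤ τ)
    (hτ : viewStart (Δ + 1) v ≤ τ) (htv : t ≤ v)
    (hp : ∀ k, ∃ ρ, r.Submitted k ρ ∧ ρ.stamp + (Δ + 1) ≤ viewStart (Δ + 1) v ∧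
      ∀ s < t, y s k ≠ ρ) :
    ∃ x, (r.st τ i).Fresh b (Δ + 1) t v x := by
  have h : ∀ k, ∃ ρ ∈ (r.st τ i).Pending b (Δ + 1) t v k,
      ∀ ρ' ∈ (r.st τ i).Pending b (Δ + 1) t v k, ρ.key ≤ ρ'.key := by
    intro k
    rw [r.pending_eq hi hy hg hτ]
    exact WellFounded.has_min (measure Request.key).wf _ (hp k) |>.imp
      fun ρ h => ⟨h.1, fun ρ' h' => not_lt.1 (h.2 ρ' h')⟩
  choose x hx using h
  exact ⟨x, htv, fun s hs => ⟨_, hy s hs⟩, hx⟩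

theorem honest_quorum (hB : B.card ≤ b) {S : Set (Fin N × Ballot (Batch F M K nX))}
    {c : Ballot (Batch F M K nX)} (h : ∀ j ∉ B, (j, c) ∈ S) : Quorum b S c := by
  refine ⟨Bᶜ, ?_, fun j hj => h j (Finset.mem_compl.1 hj)⟩
  have := Finset.card_add_card_compl B
  rw [Fintype.card_fin] at this
  omega

/-- A view with an honest leader after stabilization decides every round that can be decided. -/
theorem decided_of_honest_leader (hB : B.card ≤ b) (hN : 3 * b < N) {t v : ℕ}
    {y : ℕ → Batch F M K nX} {l : Fin N} (hl : l ∉ B) (hlv : (l : ℕ) = v % N)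
    (hg : r.gst + (Δ + 1) ≤ viewStart (Δ + 1) v) (htv : t ≤ v)
    (hy : ∀ i ∉ B, ∀ s < t, (r.st (viewStart (Δ + 1) v) i).decided b s = some (y s))
    (hp : ∀ k, ∃ ρ, r.Submitted k ρ ∧ ρ.stamp + (Δ + 1) ≤ viewStart (Δ + 1) v ∧
      ∀ s < t, y s k ≠ ρ) :
    ∃ x, ∀ i ∉ B, (r.st (viewStart (Δ + 1) (v + 1)) i).decided b t = some x := by
  set p := viewStart (Δ + 1) v with hpv
  obtain ⟨x, hx⟩ : ∃ x, pick ((r.st p l).Proposable b (Δ + 1) t v) = some x := by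
    apply exists_pick_eq_some
    by_cases hq : ∃ w < v, ∃ z, Quorum b (r.st p l).known (.vote t w z)
    · classical
      -- The leader takes the latest view below `v` in which it sees a vote quorum.
      obtain ⟨w₀, hw₀, hz₀⟩ := hq
      have hspec := Nat.findGreatest_spec
        (P := fun w => w < v ∧ ∃ z, Quorum b (r.st p l).known (.vote t w z)) hw₀.le ⟨hw₀, hz₀⟩
      obtain ⟨hw, z, hz⟩ := hspec
      exact ⟨z, Or.inl ⟨_, hw, hz, fun w' hw' z' hz' =>
        Nat.le_findGreatest hw'.le ⟨hw', z', hz'⟩⟩⟩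
    · push Not at hq
      obtain ⟨x, hx⟩ := r.exists_fresh hl (hy l hl) hg le_rfl htv hp
      exact ⟨x, Or.inr ⟨hq, hx⟩⟩
  -- A locking quorum was known one phase before the next view starts, and all knowledge is
  -- forwarded, so the leader has it at time `p`.
  have hlock : ∀ i ∉ B, ∀ w z, (t, w, z) ∈ (r.st (p + (Δ + 1)) i).locks →
      w < v ∧ Quorum b (r.st p l).known (.vote t w z) := by
    intro i hi w z h
    rw [r.mem_locks_iff hi] at h
    have hw : w < v := by
      by_contra! hw
      have := viewStart_mono (L := Δ + 1) hw
      omega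
    have := viewStart_add_le (L := Δ + 1) hw
    exact ⟨hw, h.2.mono (r.known_subset hi hl (by omega))⟩
  have hvote : ∀ i ∉ B, r.Votes i t v x := by
    intro i hi
    apply pick_eq_some
    · refine ⟨⟨l, hlv, r.mem_known_of_sent hl hi (τ := p) (by omega)
        (Or.inl ⟨rfl, hlv, r.clock_eq hl p, hx⟩)⟩, ?_⟩
      rcases pick_spec hx with ⟨w, hw, hq, hmax⟩ | ⟨hno, hf⟩
      · refine Or.inl ⟨w, hw, hq.mono (r.known_subset hl hi (by omega)), fun w' z h => ?_⟩
        obtain ⟨h1, h2⟩ := hlock i hi w' z h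
        exact hmax w' h1 z h2
      · refine Or.inr ⟨fun w' z h => ?_, htv, fun s hs =>
          ⟨_, r.decided_mono hB hN hi (by omega) (hy i hi s hs)⟩, fun k => ?_⟩
        · obtain ⟨h1, h2⟩ := hlock i hi w' z h
          exact hno w' h1 z h2
        · have hk := hf.2.2 k
          -- `pending_eq` describes the pending requests without reference to node or time, so
          -- freshness passes from leader to voter.
          rw [r.pending_eq hl (hy l hl) hg le_rfl] at hk
          rwa [r.pending_eq hi (fun s hs => r.decided_mono hB hN hi (by omega) (hy i hi s hs))
            (by omega) (by omega)]
    -- An honest leader signs one proposal per round and view, so no other value is acceptable.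
    · rintro z ⟨⟨l', hl', hk⟩, -⟩
      obtain rfl : l' = l := Fin.ext (hl'.trans hlv.symm)
      obtain ⟨σ, -, -, h1, h2⟩ := r.issues_of_known hi hl hk
      rw [r.clock_eq hl] at h1
      rw [h1, hx] at h2
      exact (Option.some.inj h2).symm
  have hcommit : ∀ i ∉ B, Quorum b (r.st (p + 2 * (Δ + 1)) i).known (.vote t v x) := fun i hi =>
    honest_quorum hB fun j hj => r.mem_known_of_sent hj hi (τ := p + (Δ + 1)) (by omega)
      (Or.inl ⟨rfl, r.clock_eq hj _, hvote j hj⟩)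
  have hdec : ∀ i ∉ B, Quorum b (r.st (viewStart (Δ + 1) (v + 1)) i).known (.commit t v x) :=
    fun i hi => honest_quorum hB fun j hj => r.mem_known_of_sent hj hi (τ := p + 2 * (Δ + 1))
      (by rw [viewStart_succ]; omega) (Or.inl ⟨rfl, r.clock_eq hj _, hcommit j hj⟩)
  refine ⟨x, fun i hi => ?_⟩
  apply pick_eq_some
  · exact ⟨v, hdec i hi⟩
  · rintro z ⟨w, hw⟩
    exact (r.commitQuorum_of_known hi hw).unique hB hN (r.commitQuorum_of_known hi (hdec i hi))

/-- Every round is eventually decided by all honest nodes. -/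
theorem exists_decided (hB : B.card ≤ b) (hN : 3 * b < N) (t : ℕ) :
    ∃ x τ, ∀ i ∉ B, (r.st τ i).decided b t = some x := by
  induction t using Nat.strong_induction_on with
  | _ t ih =>
  have ih' : ∀ s, ∃ x τ, s < t → ∀ i ∉ B, (r.st τ i).decided b s = some x := by
    intro s
    by_cases hs : s < t
    · obtain ⟨x, τ, h⟩ := ih s hs
      exact ⟨x, τ, fun _ => h⟩
    · have hex : ∃ x : Batch F M K nX, True := by
        have : ∀ k, ∃ ρ : Request F M nX, True := fun k => by
          obtain ⟨τ, m, -, h⟩ := r.submit_often k 0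
          obtain ⟨c, -⟩ := Option.isSome_iff_exists.1 h
          exact ⟨⟨m, τ, c⟩, trivial⟩
        choose x _ using this
        exact ⟨x, trivial⟩
      obtain ⟨x, -⟩ := hex
      exact ⟨x, 0, fun h => absurd h hs⟩
  choose y T hT using ih'
  choose ρ hρ hne using fun k => r.exists_submitted_ne k t y
  obtain ⟨l, -, -, hl⟩ := exists_honest_mem_inter hB hN (Q := Finset.univ) (Q' := Finset.univ)
    (by simp) (by simp)
  -- The bound `m` lies beyond stabilization, the round index, all earlier decisions and the
  -- maturing of one unused request per machine. View `l + N * m` is later still and is led by the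
  -- honest node `l`.
  set m := r.gst + (Δ + 1) + t + (Finset.range t).sup T +
    (Finset.univ.sup (fun k => (ρ k).stamp) + (Δ + 1)) with hm
  have hNpos : 0 < N := by omega
  have hmv : m ≤ l + N * m := by nlinarith
  have hv : l + N * m ≤ viewStart (Δ + 1) (l + N * m) := le_viewStart (by omega)
  obtain ⟨x, hx⟩ := r.decided_of_honest_leader hB hN (t := t) (v := l + N * m) (y := y) hl
    (by rw [Nat.add_mul_mod_self_left, Nat.mod_eq_of_lt l.2]) (by omega) (by omega)
    (fun i hi s hs => by
      have := Finset.le_sup (f := T) (Finset.mem_range.2 hs)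
      exact r.decided_mono hB hN hi (by omega) (hT s hs i hi))
    (fun k => ⟨ρ k, hρ k, by
      have := Finset.le_sup (f := fun k => (ρ k).stamp) (Finset.mem_univ k)
      omega, hne k⟩)
  exact ⟨x, _, hx⟩

/-- Every submitted request is selected for some round. -/
theorem exists_selected (hB : B.card ≤ b) (hN : 3 * b < N) {X : ℕ → Batch F M K nX}
    (hX : ∀ t, ∃ τ, ∀ i ∉ B, (r.st τ i).decided b t = some (X t)) {k : Fin K}
    {ρ : Request F M nX} (hρ : r.Submitted k ρ) : ∃ t, X t k = ρ := by
  by_contra! hno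
  obtain ⟨l, -, -, hl⟩ := exists_honest_mem_inter hB hN (Q := Finset.univ) (Q' := Finset.univ)
    (by simp) (by simp)
  have hun : ∀ {j s τ y}, j ∉ B → (r.st τ j).decided b s = some y → y = X s := by
    intro j s τ y hj h
    obtain ⟨τ', h'⟩ := hX s
    exact r.decided_unique hB hN hj hj h (h' j hj)
  have hfresh : ∀ t, ∃ j ∉ B, ∃ w,
      (r.st (viewStart (Δ + 1) w + (Δ + 1)) j).Fresh b (Δ + 1) t w (X t) := by
    intro t
    obtain ⟨τ, h⟩ := hX t
    obtain ⟨j, hj, w, -, hf⟩ := r.exists_fresh_of_decided hB hN hl (h l hl)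
    exact ⟨j, hj, w, hf⟩
  -- Freshness for round `m + t` forces a view index of at least `m`, hence a time when `ρ` is known
  -- and pending. Every command selected from round `m` on then has a key at most that of `ρ`, but
  -- these keys are pairwise distinct: only finitely many fit.
  set m := r.gst + (ρ.stamp + (Δ + 1)) with hm
  have hle : ∀ t, (X (m + t) k).key ≤ ρ.key := by
    intro t
    obtain ⟨j, hj, w, htw, hdec, hf⟩ := hfresh (m + t)
    have hw : w ≤ viewStart (Δ + 1) w := le_viewStart (by omega)
    refine (hf k).2 ρ ⟨r.mem_reqs_of_submitted hj hρ (by omega) (by omega), by omega,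
      fun s hs y hy => ?_⟩
    rw [hun hj hy]
    exact hno s
  have hsub : ∀ t, r.Submitted k (X t k) := by
    intro t
    obtain ⟨τ, h⟩ := hX t
    exact (r.submitted_of_decided hB hN hl (h l hl) k).1
  have hne : ∀ s t, s < t → X s k ≠ X t k := by
    intro s t hst
    obtain ⟨j, hj, w, htw, hdec, hf⟩ := hfresh t
    obtain ⟨y, hy⟩ := hdec s hst
    have := (hf k).1.2.2 s hst y hy
    rwa [hun hj hy] at this
  have hinj : Function.Injective fun t => (X (m + t) k).key := by
    intro s t h
    obtain ⟨h1, h2⟩ := Request.stamp_client_eq_of_key_eq h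
    have h3 : X (m + s) k = X (m + t) k := by
      have hs := hsub (m + s)
      have ht := hsub (m + t)
      unfold Submitted at hs ht
      rw [h1, h2, ht] at hs
      have hc := Option.some.inj hs
      cases hs' : X (m + s) k
      cases ht' : X (m + t) k
      simp_all
    rcases lt_trichotomy s t with h | h | h
    · exact absurd h3 (hne _ _ (by omega))
    · exact h
    · exact absurd h3.symm (hne _ _ (by omega))
  exact Set.infinite_of_injective_forall_mem hinj (s := Set.Iic ρ.key) hle (Set.finite_Iic _)

end Execution

end consensus

/-! ## Coded execution -/

open Classical in
/-- The nodes that report the output `y`. -/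
noncomputable def reporters {F : Type u} {N nY : ℕ} (rep : Fin N → Option (Fin nY → F))
    (y : Fin nY → F) : Finset (Fin N) :=
  Finset.univ.filter fun i => rep i = some y

theorem mem_reporters {F : Type u} {N nY : ℕ} {rep : Fin N → Option (Fin nY → F)}
    {y : Fin nY → F} {i : Fin N} :
    i ∈ reporters rep y ↔ rep i = some y := by
  classical
  simp [reporters]

section coding

open Polynomial

variable {F : Type u} [Field F] {N M K nS nX nY : ℕ}

/-- The vector of polynomials of degree less than `K` that takes the value `s k` at
the point `ω k`. -/
noncomputable def interpolant {n : ℕ} (ω : Fin K ↪ F) (s : Fin K → Fin n → F) (c : Fin n) : F[X] :=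
  Lagrange.interpolate Finset.univ ω fun k => s k c

theorem eval_interpolant {n : ℕ} (ω : Fin K ↪ F) (s : Fin K → Fin n → F) (c : Fin n) (k : Fin K) :
    (interpolant ω s c).eval (ω k) = s k c :=
  Lagrange.eval_interpolate_at_node _ ω.injective.injOn (Finset.mem_univ k)

theorem natDegree_interpolant_le {n : ℕ} (ω : Fin K ↪ F) (s : Fin K → Fin n → F) (c : Fin n) :
    (interpolant ω s c).natDegree ≤ K - 1 := by
  have := Lagrange.degree_interpolate_le (s := Finset.univ) (v := ω) (fun k => s k c)
    ω.injective.injOn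
  rw [Finset.card_fin] at this
  exact natDegree_le_of_degree_le this

/-- The values at `a` of a vector of polynomials, split into next state and output. -/
noncomputable def readAt (H : Fin nS ⊕ Fin nY → F[X]) (a : F) : (Fin nS → F) × (Fin nY → F) :=
  (fun c => (H (.inl c)).eval a, fun c => (H (.inr c)).eval a)

namespace PolyMachine

variable (p : PolyMachine F nS nX nY)

/-- The composition of the transition polynomials with the interpolants of states and inputs. -/
noncomputable def codeword (ω : Fin K ↪ F) (s : Fin K → Fin nS → F) (x : Fin K → Fin nX → F)
    (c : Fin nS ⊕ Fin nY) : F[X] :=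
  MvPolynomial.aeval (Sum.elim (interpolant ω s) (interpolant ω x)) (Sum.elim p.next p.out c)

/-- Evaluation at `a` is a ring homomorphism and so passes through the transition polynomials: a
node computes a codeword symbol from its coded data alone. -/
theorem readAt_codeword (ω : Fin K ↪ F) (s : Fin K → Fin nS → F) (x : Fin K → Fin nX → F) (a : F) :
    readAt (p.codeword ω s x) a =
      p.step (fun c => (interpolant ω s c).eval a) (fun c => (interpolant ω x c).eval a) := by
  have h : ∀ q : MvPolynomial (Fin nS ⊕ Fin nX) F,
      (MvPolynomial.aeval (Sum.elim (interpolant ω s) (interpolant ω x)) q).eval a =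
        MvPolynomial.eval (Sum.elim (fun c => (interpolant ω s c).eval a)
          (fun c => (interpolant ω x c).eval a)) q := by
    intro q
    rw [← coe_evalRingHom, MvPolynomial.aeval_def, MvPolynomial.hom_eval₂, MvPolynomial.eval,
      MvPolynomial.coe_eval₂Hom]
    congr 1
    · ext; simp
    · ext (i | i) <;> rfl
  exact Prod.ext (funext fun c => h _) (funext fun c => h _)

theorem readAt_codeword_node (ω : Fin K ↪ F) (s : Fin K → Fin nS → F) (x : Fin K → Fin nX → F)
    (k : Fin K) : readAt (p.codeword ω s x) (ω k) = p.step (s k) (x k) := by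
  rw [readAt_codeword]
  simp only [eval_interpolant]

theorem natDegree_codeword_le {d : ℕ} (hp : p.DegreeLE d) (ω : Fin K ↪ F)
    (s : Fin K → Fin nS → F) (x : Fin K → Fin nX → F) (c : Fin nS ⊕ Fin nY) :
    (p.codeword ω s x c).natDegree ≤ d * (K - 1) := by
  refine (MvPolynomial.aeval_natDegree_le _ ?_ _ fun i => ?_ :
    (p.codeword ω s x c).natDegree ≤ d * (K - 1))
  · cases c with
    | inl c => exact hp.1 c
    | inr c => exact hp.2 c
  · cases i with
    | inl i => exact natDegree_interpolant_le ω s i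
    | inr i => exact natDegree_interpolant_le ω x i

end PolyMachine

/-! ### Decoding with missing and false results -/

/-- The nodes whose result is available. -/
def available {R : Type u} (res : Fin N → Option R) : Finset (Fin N) :=
  Finset.univ.filter fun j => (res j).isSome

open Classical in
/-- The nodes whose result is available but differs from what the polynomials `H` predict. -/
noncomputable def mismatches (α : Fin N ↪ F) (res : Fin N → Option ((Fin nS → F) × (Fin nY → F)))
    (H : Fin nS ⊕ Fin nY → F[X]) : Finset (Fin N) :=
  Finset.univ.filter fun j => ∃ g, res j = some g ∧ g ≠ readAt H (α j)

/-- The polynomials `H` of degree at most `D` explain all but at most `b` of at least `N - b`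
available results. -/
def Explains (α : Fin N ↪ F) (b D : ℕ) (res : Fin N → Option ((Fin nS → F) × (Fin nY → F)))
    (H : Fin nS ⊕ Fin nY → F[X]) : Prop :=
  (∀ c, (H c).natDegree ≤ D) ∧ N ≤ (available res).card + b ∧ (mismatches α res H).card ≤ b

/-- Of at least N - b available results at most 2b contradict one of the two families, so they agree
at more than `D` points. -/
theorem Explains.unique {α : Fin N ↪ F} {b D : ℕ} (hD : D + 3 * b < N)
    {res : Fin N → Option ((Fin nS → F) × (Fin nY → F))} {H H' : Fin nS ⊕ Fin nY → F[X]}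
    (h : Explains α b D res H) (h' : Explains α b D res H') : H = H' := by
  set A := available res \ (mismatches α res H ∪ mismatches α res H') with hA
  have hcard : D < A.card := by
    have h1 := Finset.le_card_sdiff (mismatches α res H ∪ mismatches α res H') (available res)
    have h2 := Finset.card_union_le (mismatches α res H) (mismatches α res H')
    rw [← hA] at h1
    have := h.2.1
    have := h.2.2
    have := h'.2.2
    omega
  have hag : ∀ j ∈ A, readAt H (α j) = readAt H' (α j) := by
    intro j hj
    simp only [hA, Finset.mem_sdiff, available, Finset.mem_filter, Finset.mem_univ, true_and,
      Finset.mem_union, mismatches, not_or, not_exists, not_and, not_not] at hj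
    obtain ⟨h1, h2, h3⟩ := hj
    obtain ⟨g, hg⟩ := Option.isSome_iff_exists.1 h1
    rw [← h2 g hg, ← h3 g hg]
  funext c
  refine eq_of_natDegree_lt_card_of_eval_eq' (H c) (H' c) (A.map α) ?_ ?_
  · intro a ha
    obtain ⟨j, hj, rfl⟩ := Finset.mem_map.1 ha
    cases c with
    | inl c => exact congrFun (congrArg Prod.fst (hag j hj)) c
    | inr c => exact congrFun (congrArg Prod.snd (hag j hj)) c
  · rw [Finset.card_map]
    exact (max_le (h.1 c) (h'.1 c)).trans_lt hcard

/-- The scheme in which node `i` stores the value at `α i` of the interpolant of the states, applies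
the transition function to it and to the value of the interpolant of the commands, and decodes the
results of all nodes as a Reed-Solomon code with at most `b` errors. -/
noncomputable def codedScheme (M : ℕ) (α : Fin N ↪ F) (ω : Fin K ↪ F)
    (p : PolyMachine F nS nX nY) (b Δ D : ℕ) : Scheme F N M K nS nX nY where
  consensus := quorumConsensus F N M K nX b (Δ + 1)
  storeDim := nS
  encode _ i s c := (interpolant ω s c).eval (α i)
  Result := (Fin nS → F) × (Fin nY → F)
  compute _ i z x := p.step z fun c => (interpolant ω x c).eval (α i)
  dest _ _ := Finset.univ
  covers _ _ := Finset.univ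
  decode _ _ res := (pick (Explains α b D res)).map fun H k => readAt H (ω k)
  update _ i _ s c := (interpolant ω (fun k => s ⟨k, Finset.mem_univ k⟩) c).eval (α i)
  update_encode _ _ _ _ := by simp
  clientDecide _ _ rep := pick fun y => b < (reporters rep y).card

theorem storageEfficiency_codedScheme (α : Fin N ↪ F) (ω : Fin K ↪ F)
    (p : PolyMachine F nS nX nY) (b Δ D : ℕ) (hnS : 1 ≤ nS) :
    (codedScheme M α ω p b Δ D).storageEfficiency = K := by
  have hdim : (codedScheme M α ω p b Δ D).storeDim = nS := rfl
  have hnS' : (nS : ℝ) ≠ 0 := by positivity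
  unfold Scheme.storageEfficiency
  rw [hdim]
  split_ifs with hF
  · apply mul_div_cancel_right₀
    have : 1 < Nat.card F := Finite.one_lt_card
    rw [Nat.card_fun, Nat.card_fin]
    push_cast
    rw [Real.log_pow]
    exact mul_ne_zero hnS' (Real.log_pos (by exact_mod_cast this)).ne'
  · exact mul_div_cancel_right₀ _ hnS'

end coding

/-! ### Security of coded execution -/

theorem arrivedBy_eq_some {A : Type u} {τ : ℕ} {o : Option (ℕ × A)} {v : A} :
    arrivedBy τ o = some v ↔ ∃ a ≤ τ, o = some (a, v) := by
  rcases o with _ | ⟨a, w⟩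
  · simp [arrivedBy]
  · simp only [arrivedBy]
    split_ifs with h
    · constructor
      · rintro ⟨⟩
        exact ⟨a, h, rfl⟩
      · rintro ⟨a', -, ⟨⟩⟩
        rfl
    · constructor
      · rintro ⟨⟩
      · rintro ⟨a', h', ⟨⟩⟩
        exact absurd h' h

theorem trueState_congr {F : Type u} {M K nS nX nY : ℕ}
    (f : (Fin nS → F) → (Fin nX → F) → (Fin nS → F) × (Fin nY → F))
    (s₀ : Fin K → Fin nS → F) {x x' : ℕ → Fin K → Request F M nX} {t : ℕ}
    (h : ∀ t' < t, x t' = x' t') : trueState f s₀ x t = trueState f s₀ x' t := by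
  induction t with
  | zero => rfl
  | succ t ih =>
    funext k
    simp only [trueState]
    rw [ih fun t' ht' => h t' (by omega), h t (by omega)]

section security

variable {F : Type u} [Field F] {N M K nS nX nY : ℕ}

variable {α : Fin N ↪ F} {ω : Fin K ↪ F} {p : PolyMachine F nS nX nY} {b Δ D : ℕ}
  {B : Finset (Fin N)} {r : RunData (codedScheme M α ω p b Δ D)}

/-- The consensus phase of a run of the coded scheme. -/
noncomputable def RunData.IsRun.toExecution (h : r.IsRun Δ B) : Execution F N M K nX b Δ B where
  gst := r.gst
  submit := r.submit
  submitArr := r.submitArr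
  sent := r.sent
  sentArr := r.sentArr
  st := r.st
  submit_often := h.submit_often
  submit_timely := h.submit_timely
  sent_later := h.sent_later
  sent_timely τ i hi j hj := (h.sent_timely τ i hi j hj).2
  sent_honest := h.sent_honest
  sent_faulty := h.sent_faulty
  st_zero := h.st_zero
  st_succ := h.st_succ

end security

/-! ### Runs with their sequence of selected commands -/

section selected

variable {F : Type u} [Field F] {N M K nS nX nY : ℕ} {α : Fin N ↪ F} {ω : Fin K ↪ F}
  {p : PolyMachine F nS nX nY} {b Δ D : ℕ} {B : Finset (Fin N)}
  {r : RunData (codedScheme M α ω p b Δ D)} {X : ℕ → Batch F M K nX}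

/-- A run of the coded scheme with at most `b` faulty nodes and the commands `X` selected in it. -/
structure SelectedRun (r : RunData (codedScheme M α ω p b Δ D)) (B : Finset (Fin N))
    (X : ℕ → Batch F M K nX) : Prop where
  isRun : r.IsRun Δ B
  card_le : B.card ≤ b
  degree_lt : D + 3 * b < N
  natDegree_le : ∀ s x c, (p.codeword ω s x c).natDegree ≤ D
  decides : ∀ t, ∃ τ, ∀ i ∉ B, r.Decides i τ t (X t)

namespace SelectedRun

/-- The polynomials whose values are the true results of round `t`. -/
noncomputable def codeword (r : RunData (codedScheme M α ω p b Δ D)) (X : ℕ → Batch F M K nX)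
    (t : ℕ) : Fin nS ⊕ Fin nY → Polynomial F :=
  p.codeword ω (trueState p.step r.s₀ X t) fun k => (X t k).cmd

/-- The data stored by node `i` at time `τ` are those for its current round. -/
def StoreCorrect (r : RunData (codedScheme M α ω p b Δ D)) (X : ℕ → Batch F M K nX) (τ : ℕ)
    (i : Fin N) : Prop :=
  r.store τ i = (codedScheme M α ω p b Δ D).encode (r.round τ i) i
    (trueState p.step r.s₀ X (r.round τ i))

theorem exists_computes {i : Fin N} {τ t : ℕ} {x} (h1 : r.round τ i = t)
    (h2 : r.Decides i τ t x) : ∃ σ g, r.Computes i σ t g := by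
  classical
  have hex : ∃ τ, r.round τ i = t ∧ ∃ x, r.Decides i τ t x := ⟨τ, h1, x, h2⟩
  obtain ⟨h3, x', h4⟩ := Nat.find_spec hex
  exact ⟨Nat.find hex, _, h3, ⟨x', h4, rfl⟩, fun σ hσ => Nat.find_min hex hσ⟩

variable (h : SelectedRun r B X)

include h

theorem three_mul_lt : 3 * b < N := by
  have := h.degree_lt
  omega

theorem decides_eq {i : Fin N} (hi : i ∉ B) {τ t : ℕ} {x : Batch F M K nX}
    (hx : r.Decides i τ t x) : x = X t := by
  obtain ⟨τ', h'⟩ := h.decides t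
  exact h.isRun.toExecution.decided_unique h.card_le h.three_mul_lt hi hi hx (h' i hi)

theorem decides_mono {i : Fin N} (hi : i ∉ B) {τ τ' t : ℕ} (hτ : τ ≤ τ')
    (hx : r.Decides i τ t (X t)) : r.Decides i τ' t (X t) :=
  h.isRun.toExecution.decided_mono h.card_le h.three_mul_lt hi hτ hx

theorem computes_eq {i : Fin N} (hi : i ∉ B) {τ t : ℕ} {g} (hst : StoreCorrect r X τ i)
    (hg : r.Computes i τ t g) : g = readAt (codeword r X t) (α i) := by
  obtain ⟨rfl, ⟨x, hx, rfl⟩, -⟩ := hg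
  rw [hst, h.decides_eq hi hx, codeword, PolyMachine.readAt_codeword]
  rfl

theorem result_of_computes {i j : Fin N} (hi : i ∉ B) {τ t : ℕ} {g} (hg : r.Computes i τ t g) :
    ∃ a, τ ≤ a ∧ r.result t i j = some (a, g) := by
  by_cases hij : j = i
  · subst hij
    exact ⟨τ, le_rfl, h.isRun.result_self j hi τ t g hg⟩
  · obtain ⟨a, ha, h', -⟩ := h.isRun.result_other i hi τ t g hg j (Finset.mem_univ j) hij
    exact ⟨a, h'.le, ha⟩

/-- A result is computed no later than it arrives, so correct storage up to `τ` suffices; this keeps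
the induction over time from being circular. -/
theorem result_eq {τ : ℕ} (hst : ∀ σ ≤ τ, ∀ i ∉ B, StoreCorrect r X σ i) {i j : Fin N}
    (hi : i ∉ B) {t a : ℕ} (ha : a ≤ τ) {g} (hr : r.result t i j = some (a, g)) :
    g = readAt (codeword r X t) (α i) := by
  obtain ⟨-, σ, hc⟩ := h.isRun.result_only i hi t j a g hr
  obtain ⟨a', ha', hr'⟩ := h.result_of_computes (j := j) hi hc
  rw [hr] at hr'
  obtain ⟨rfl, -⟩ := Prod.ext_iff.1 (Option.some.inj hr')
  exact h.computes_eq hi (hst σ (ha'.trans ha) i hi) hc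

theorem card_mismatches_le {τ : ℕ} (hst : ∀ σ ≤ τ, ∀ i ∉ B, StoreCorrect r X σ i)
    (i : Fin N) (t : ℕ) :
    (mismatches α (fun j => arrivedBy τ (r.result t j i)) (codeword r X t)).card ≤ b := by
  refine (Finset.card_le_card fun j hj => ?_).trans h.card_le
  simp only [mismatches, Finset.mem_filter, Finset.mem_univ, true_and] at hj
  obtain ⟨g, hg, hne⟩ := hj
  by_contra hB
  obtain ⟨a, ha, hr⟩ := arrivedBy_eq_some.1 hg
  exact hne (h.result_eq hst hB ha hr)

theorem explains {τ : ℕ} (hst : ∀ σ ≤ τ, ∀ i ∉ B, StoreCorrect r X σ i) {i : Fin N} {t : ℕ}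
    (ha : N ≤ (available fun j => arrivedBy τ (r.result t j i)).card + b) :
    Explains α b D (fun j => arrivedBy τ (r.result t j i)) (codeword r X t) :=
  ⟨h.natDegree_le _ _, ha, h.card_mismatches_le hst i t⟩

/-- What an honest node recovers is true. -/
theorem completes_eq_of_storeCorrect {τ : ℕ} (hst : ∀ σ ≤ τ, ∀ i ∉ B, StoreCorrect r X σ i) {i : Fin N}
    {t : ℕ} {x e} (hc : r.Completes i τ t x e) (k) :
    e k = p.step (trueState p.step r.s₀ X t k) (X t k).cmd := by
  obtain ⟨-, -, hd⟩ := hc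
  obtain ⟨H, hH, rfl⟩ := Option.map_eq_some_iff.1 hd
  have hH' := pick_spec hH
  -- The chosen `H` itself certifies that enough results are available for the true polynomials to
  -- be an explanation too.
  rw [hH'.unique h.degree_lt (h.explains hst hH'.2.1), codeword]
  exact p.readAt_codeword_node ω _ _ _

/-- Correct storage up to `τ` makes whatever is decoded at `τ` true, and re-encoding the true next
states gives correct storage at `τ + 1`. -/
theorem storeCorrect (τ : ℕ) : ∀ i ∉ B, StoreCorrect r X τ i := by
  induction τ using Nat.strong_induction_on with
  | _ τ ih =>
  intro i hi
  rcases τ with _ | τ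
  · rw [StoreCorrect, h.isRun.store_zero i hi, h.isRun.round_zero i hi]
    rfl
  · have hst : ∀ σ ≤ τ, ∀ i ∉ B, StoreCorrect r X σ i := fun σ hσ => ih σ (by omega)
    by_cases hc : ∃ t x e, r.Completes i τ t x e
    · obtain ⟨t, x, e, hc⟩ := hc
      obtain ⟨h1, h2⟩ := h.isRun.complete τ i hi t x e hc
      rw [StoreCorrect, h1, h2]
      have : (fun k => (e k).1) = fun k => trueState p.step r.s₀ X (t + 1) k.1 := by
        funext k
        rw [h.completes_eq_of_storeCorrect hst hc k]
        rfl
      rw [this]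
      rfl
    · obtain ⟨h1, h2⟩ := h.isRun.idle τ i hi hc
      rw [StoreCorrect, h1, h2]
      exact hst τ le_rfl i hi

theorem completes_eq {τ : ℕ} {i : Fin N} {t : ℕ} {x e} (hc : r.Completes i τ t x e) (k) :
    e k = p.step (trueState p.step r.s₀ X t k) (X t k).cmd :=
  h.completes_eq_of_storeCorrect (fun σ _ => h.storeCorrect σ) hc k

/-! ### Progress -/

theorem round_succ_of_completes {i : Fin N} (hi : i ∉ B) {τ t : ℕ} {x e}
    (hc : r.Completes i τ t x e) : r.round (τ + 1) i = r.round τ i + 1 := by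
  rw [(h.isRun.complete τ i hi t x e hc).1, hc.1]

theorem round_le_succ {i : Fin N} (hi : i ∉ B) (τ : ℕ) : r.round τ i ≤ r.round (τ + 1) i := by
  by_cases hc : ∃ t x e, r.Completes i τ t x e
  · obtain ⟨t, x, e, hc⟩ := hc
    have := h.round_succ_of_completes hi hc
    omega
  · exact (h.isRun.idle τ i hi hc).1.ge

theorem round_mono {i : Fin N} (hi : i ∉ B) {τ τ' : ℕ} (hτ : τ ≤ τ') :
    r.round τ i ≤ r.round τ' i :=
  monotone_nat_of_le_succ (h.round_le_succ hi) hτ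

/-- A node that is past round `t` has completed it. -/
theorem exists_completes_of_lt {i : Fin N} (hi : i ∉ B) {τ t : ℕ} (ht : t < r.round τ i) :
    ∃ σ < τ, ∃ x e, r.Completes i σ t x e := by
  induction τ with
  | zero => rw [h.isRun.round_zero i hi] at ht; omega
  | succ τ ih =>
    by_cases hc : ∃ t x e, r.Completes i τ t x e
    · obtain ⟨t', x, e, hc⟩ := hc
      have h1 := h.round_succ_of_completes hi hc
      by_cases htt : t = r.round τ i
      · have h2 := hc.1
        obtain rfl : t' = t := by omega
        exact ⟨τ, by omega, x, e, hc⟩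
      · obtain ⟨σ, hσ, h'⟩ := ih (by omega)
        exact ⟨σ, by omega, h'⟩
    · rw [(h.isRun.idle τ i hi hc).1] at ht
      obtain ⟨σ, hσ, h'⟩ := ih ht
      exact ⟨σ, by omega, h'⟩

/-- A node that has reached round `t` computes a local result for it. -/
theorem exists_computes_of_le {i : Fin N} (hi : i ∉ B) {τ t : ℕ} (ht : t ≤ r.round τ i) :
    ∃ σ g, r.Computes i σ t g := by
  obtain ⟨τd, hd⟩ := h.decides t
  by_cases hlt : t < r.round (max τ τd) i
  · obtain ⟨σ, -, x, e, h1, h2, -⟩ := h.exists_completes_of_lt hi hlt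
    exact exists_computes h1 h2
  · have := h.round_mono hi (le_max_left τ τd)
    exact exists_computes (by omega) (h.decides_mono hi (le_max_right τ τd) (hd i hi))

/-- All honest nodes eventually reach every round. -/
theorem exists_le_round (t : ℕ) : ∃ τ, ∀ i ∉ B, t ≤ r.round τ i := by
  induction t with
  | zero => exact ⟨0, fun _ _ => Nat.zero_le _⟩
  | succ t ih =>
    obtain ⟨τ₀, h₀⟩ := ih
    obtain ⟨τd, hd⟩ := h.decides t
    have hres : ∀ i j, ∃ a, i ∉ B → ∃ g, r.result t i j = some (a, g) := by
      intro i j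
      by_cases hi : i ∈ B
      · exact ⟨0, fun h => absurd hi h⟩
      · obtain ⟨σ, g, hg⟩ := h.exists_computes_of_le hi (h₀ i hi)
        obtain ⟨a, -, ha⟩ := h.result_of_computes (j := j) hi hg
        exact ⟨a, fun _ => ⟨g, ha⟩⟩
    choose a ha using hres
    -- By this time all honest nodes have reached and decided round `t`, and all honest results have
    -- arrived. A node still in round `t` can therefore decode.
    set τ := max (max τ₀ τd) (Finset.univ.sup fun i => Finset.univ.sup (a i)) with hτ
    have haτ : ∀ i j, a i j ≤ τ := fun i j =>
      ((Finset.le_sup (f := a i) (Finset.mem_univ j)).trans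
        (Finset.le_sup (f := fun i => Finset.univ.sup (a i)) (Finset.mem_univ i))).trans
          (le_max_right _ _)
    refine ⟨τ + 1, fun i hi => ?_⟩
    have h1 := h.round_mono hi (show τ₀ ≤ τ by omega)
    have h2 := h₀ i hi
    have h3 := h.round_le_succ hi τ
    by_cases ht : r.round τ i = t
    · have hav : N ≤ (available fun j => arrivedBy τ (r.result t j i)).card + b := by
        have hsub : Bᶜ ⊆ available fun j => arrivedBy τ (r.result t j i) := by
          intro j hj
          obtain ⟨g, hg⟩ := ha j i (Finset.mem_compl.1 hj)
          rw [available, Finset.mem_filter]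
          exact ⟨Finset.mem_univ j,
            Option.isSome_iff_exists.2 ⟨g, arrivedBy_eq_some.2 ⟨_, haτ j i, hg⟩⟩⟩
        have hc := Finset.card_le_card hsub
        have h4 := Finset.card_add_card_compl B
        have h5 := h.card_le
        rw [Fintype.card_fin] at h4
        omega
      obtain ⟨H, hH⟩ := exists_pick_eq_some ⟨_, h.explains (fun σ _ => h.storeCorrect σ) hav⟩
      have hdec : (codedScheme M α ω p b Δ D).decode t i
          (fun j => arrivedBy τ (r.result t j i)) = some fun k => readAt H (ω k.1) :=
        Option.map_eq_some_iff.2 ⟨H, hH, rfl⟩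
      have := h.round_succ_of_completes hi (x := X t)
        ⟨ht, h.decides_mono hi (by omega) (hd i hi), hdec⟩
      omega
    · omega

/-- Every honest node completes every round. -/
theorem exists_completes {i : Fin N} (hi : i ∉ B) (t : ℕ) :
    ∃ τ e, r.Completes i τ t (X t) e := by
  obtain ⟨τ, hτ⟩ := h.exists_le_round (t + 1)
  obtain ⟨σ, -, x, e, hc⟩ := h.exists_completes_of_lt hi (hτ i hi)
  obtain rfl := h.decides_eq hi hc.2.1
  exact ⟨σ, e, hc⟩

/-! ### Clients -/

/-- More than `b` reports include an honest one, and honest reports are true. -/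
theorem clientDecides_eq {m : Fin M} {τ t : ℕ} {k : Fin K} {y : Fin nY → F}
    (hy : r.ClientDecides m τ t k y) : y = trueOutput p.step r.s₀ X t k := by
  have hcard : b < (reporters (fun i => arrivedBy τ (r.reply t k i m)) y).card :=
    pick_spec (p := fun y => b < (reporters (fun i => arrivedBy τ (r.reply t k i m)) y).card) hy
  obtain ⟨i, hi, hB⟩ : ∃ i ∈ reporters (fun i => arrivedBy τ (r.reply t k i m)) y, i ∉ B :=
    Finset.exists_mem_notMem_of_card_lt_card (h.card_le.trans_lt hcard)
  obtain ⟨a, -, ha⟩ := arrivedBy_eq_some.1 (mem_reporters.1 hi)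
  obtain ⟨σ, x, e, hc, -, hk, rfl⟩ := h.isRun.reply_only i hB t k m a y ha
  rw [h.completes_eq hc]
  rfl

theorem exists_clientDecides (t : ℕ) (k : Fin K) :
    ∃ τ y, r.ClientDecides (X t k).client τ t k y := by
  have hrep : ∀ i, ∃ a, i ∉ B → r.reply t k i (X t k).client =
      some (a, trueOutput p.step r.s₀ X t k) := by
    intro i
    by_cases hi : i ∈ B
    · exact ⟨0, fun h => absurd hi h⟩
    · obtain ⟨σ, e, hc⟩ := h.exists_completes hi t
      obtain ⟨a, ha, -⟩ := h.isRun.reply_sent i hi σ t _ e hc ⟨k, Finset.mem_univ k⟩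
      rw [h.completes_eq hc] at ha
      exact ⟨a, fun _ => ha⟩
  choose a ha using hrep
  refine ⟨Finset.univ.sup a, exists_pick_eq_some ⟨trueOutput p.step r.s₀ X t k, ?_⟩⟩
  have hsub : Bᶜ ⊆ reporters (fun i => arrivedBy (Finset.univ.sup a)
      (r.reply t k i (X t k).client)) (trueOutput p.step r.s₀ X t k) := by
    intro i hi
    exact mem_reporters.2 (arrivedBy_eq_some.2
      ⟨a i, Finset.le_sup (Finset.mem_univ i), ha i (Finset.mem_compl.1 hi)⟩)
  have hc := Finset.card_le_card hsub
  have h1 := Finset.card_add_card_compl B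
  have h2 := h.card_le
  have h3 := h.three_mul_lt
  rw [Fintype.card_fin] at h1
  omega

end SelectedRun

/-- The coded scheme tolerates `b` faulty nodes if `D + 3 * b < N`, where `D` bounds the degrees of
the composed polynomials. -/
theorem secure_codedScheme (M Δ : ℕ) (hD : D + 3 * b < N)
    (hdeg : ∀ s x c, (p.codeword ω s x c).natDegree ≤ D) :
    (codedScheme M α ω p b Δ D).Secure Δ p.step b := by
  intro B hB r hr
  choose X hX using hr.toExecution.exists_decided hB (by omega)
  have h : SelectedRun r B X := ⟨hr, hB, hD, hdeg, hX⟩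
  refine ⟨?_, ?_, ?_, ?_⟩
  · intro i hi τ t x hx k
    exact hr.toExecution.submitted_of_decided hB h.three_mul_lt hi hx k
  · intro i hi j hj τ τ' t x x' hx hx'
    rw [h.decides_eq hi hx, h.decides_eq hj hx']
  · intro x t hx
    have hxX : ∀ t' ≤ t, x t' = X t' := fun t' ht' => by
      obtain ⟨i, hi, τ, hd⟩ := hx t' ht'
      exact h.decides_eq hi hd
    have hst := trueState_congr p.step r.s₀ (t := t) fun t' ht' => hxX t' ht'.le
    refine ⟨fun i hi τ x' e hc k => ?_, fun k τ y hy => ?_⟩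
    · rw [h.completes_eq hc, trueState, hst, hxX t le_rfl]
    · rw [h.clientDecides_eq hy, trueOutput, trueOutput, hst, hxX t le_rfl]
  · intro τ m k c hs
    obtain ⟨t, ht⟩ := hr.toExecution.exists_selected hB h.three_mul_lt hX
      (k := k) (ρ := ⟨m, τ, c⟩) hs
    refine ⟨t, fun i hi => ?_, ?_⟩
    · obtain ⟨τ', e, hc⟩ := h.exists_completes hi t
      exact ⟨τ', X t, e, hc, ht⟩
    · obtain ⟨τ', y, hy⟩ := h.exists_clientDecides t k
      rw [ht] at hy
      exact ⟨τ', y, hy⟩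

end selected

/-! ### Optimality of the number of tolerated faults -/

section silent

variable {F : Type u} [Field F] {N K nS nX nY : ℕ}

/-- The local states and the incoming statements at every time, if the nodes in `B` are silent, all
delays are equal to `1`, and every client submits the command `0` to every machine all the time. -/
noncomputable def silentPhase (F : Type u) [Field F] (N M K nX b Δ : ℕ) (B : Finset (Fin N)) :
    ℕ → (Fin N → NodeState F N M K nX) × Set (Fin N × Ballot (Batch F M K nX))
  | 0 => (fun _ => ⟨0, ∅, ∅, ∅⟩, ∅)
  | τ + 1 =>
    (fun i => ((silentPhase F N M K nX b Δ B τ).1 i).next b (Δ + 1)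
        (silentPhase F N M K nX b Δ B τ).2
        {q | some (0 : Fin nX → F) = some q.2.cmd ∧ q.2.stamp + 1 = τ},
      {c | ∃ i ∉ B, c ∈ ((silentPhase F N M K nX b Δ B τ).1 i).sends b (Δ + 1) i})

variable {M b Δ : ℕ} {B : Finset (Fin N)}

theorem mem_known_silentPhase (τ : ℕ) (i : Fin N) (c : Fin N × Ballot (Batch F M K nX)) :
    c ∈ ((silentPhase F N M K nX b Δ B τ).1 i).known ↔
      ∃ σ < τ, c ∈ (silentPhase F N M K nX b Δ B σ).2 := by
  induction τ with
  | zero => simp [silentPhase]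
  | succ τ ih =>
    simp only [silentPhase, NodeState.next, Set.mem_union, ih]
    constructor
    · rintro (⟨σ, h, h'⟩ | h)
      · exact ⟨σ, by omega, h'⟩
      · exact ⟨τ, by omega, h⟩
    · rintro ⟨σ, h, h'⟩
      rcases Nat.lt_succ_iff_lt_or_eq.1 h with h | rfl
      · exact Or.inl ⟨σ, h, h'⟩
      · exact Or.inr h'

theorem signer_notMem_of_silentPhase (τ : ℕ) : ∀ c : Fin N × Ballot (Batch F M K nX),
    c ∈ (silentPhase F N M K nX b Δ B τ).2 → c.1 ∉ B := by
  induction τ using Nat.strong_induction_on with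
  | _ τ ih =>
  intro c hc
  rcases τ with _ | τ
  · exact absurd hc (Set.notMem_empty c)
  · obtain ⟨i, hi, h | h⟩ := hc
    · rw [h.1]; exact hi
    · obtain ⟨σ, hσ, h⟩ := (mem_known_silentPhase τ i c).1 h
      exact ih σ (by omega) c h

variable (α : Fin N ↪ F) (ω : Fin K ↪ F) (p : PolyMachine F nS nX nY)

open Classical in
/-- The run in which the nodes in `B` are silent. -/
noncomputable def silentRun (M b Δ D : ℕ) (B : Finset (Fin N)) :
    RunData (codedScheme M α ω p b Δ D) where
  gst := 0
  s₀ _ _ := 0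
  submit _ _ _ := some 0
  submitArr τ _ _ _ := τ + 1
  sent τ i _ := if i ∈ B then ∅ else ((silentPhase F N M K nX b Δ B τ).1 i).sends b (Δ + 1) i
  sentArr τ _ _ := τ + 1
  st τ := (silentPhase F N M K nX b Δ B τ).1
  round _ _ := 0
  store _ i := (codedScheme M α ω p b Δ D).encode 0 i fun _ _ => 0
  result _ _ _ := none
  reply _ _ _ _ := none

theorem inbox_silentRun (D τ : ℕ) (j : Fin N) :
    (silentRun α ω p M b Δ D B).inbox τ j = (silentPhase F N M K nX b Δ B τ).2 := by
  ext c
  change (∃ σ i, σ + 1 = τ ∧ c ∈ if i ∈ B then ∅ else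
    ((silentPhase F N M K nX b Δ B σ).1 i).sends b (Δ + 1) i) ↔ _
  constructor
  · rintro ⟨σ, i, rfl, hc⟩
    split_ifs at hc with hi
    · exact absurd hc (Set.notMem_empty c)
    · exact ⟨i, hi, hc⟩
  · intro hc
    rcases τ with _ | τ
    · exact absurd hc (Set.notMem_empty c)
    · obtain ⟨i, hi, hc⟩ := hc
      exact ⟨τ, i, rfl, by rwa [if_neg hi]⟩

/-- Only nodes outside `B` ever sign, and they are fewer than N - b. -/
theorem not_decides_silentRun (hB : b < B.card) (D : ℕ) (i : Fin N) (τ t : ℕ)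
    (x : Batch F M K nX) : ¬ (silentRun α ω p M b Δ D B).Decides i τ t x := by
  intro h
  obtain ⟨v, Q, hQ, hc⟩ := pick_spec (p := fun x => ∃ v, Quorum b
    ((silentPhase F N M K nX b Δ B τ).1 i).known (.commit t v x)) h
  have hsub : Q ⊆ Bᶜ := fun j hj => by
    obtain ⟨σ, -, hσ⟩ := (mem_known_silentPhase τ i _).1 (hc j hj)
    exact Finset.mem_compl.2 (signer_notMem_of_silentPhase σ _ hσ)
  have h1 := Finset.card_le_card hsub
  have h2 := Finset.card_add_card_compl B
  rw [Fintype.card_fin] at h2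
  omega

/-- Without decisions nothing is computed or completed, so the execution rules hold vacuously; unit
delays are legal because `Δ` is positive. -/
theorem isRun_silentRun (hM : 1 ≤ M) (hΔ : 1 ≤ Δ) (hB : b < B.card) (D : ℕ) :
    (silentRun α ω p M b Δ D B).IsRun Δ B := by
  have hno : ∀ i τ t x, ¬ (silentRun α ω p M b Δ D B).Decides i τ t x :=
    not_decides_silentRun α ω p hB D
  have hcompl : ∀ i τ t x e, ¬ (silentRun α ω p M b Δ D B).Completes i τ t x e :=
    fun i τ t x e h => hno i τ t x h.2.1
  have hcomp : ∀ i τ t g, ¬ (silentRun α ω p M b Δ D B).Computes i τ t g := by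
    rintro i τ t g ⟨-, ⟨x, hx, -⟩, -⟩
    exact hno i τ t x hx
  have htime : ∀ τ, (silentRun α ω p M b Δ D B).Timely Δ τ (τ + 1) := fun τ =>
    ⟨by omega, by have := le_max_left τ (silentRun α ω p M b Δ D B).gst; omega⟩
  exact {
    submit_often := fun k τ => ⟨τ, ⟨0, hM⟩, le_rfl, rfl⟩
    submit_timely := fun τ _ _ _ _ => htime τ
    sent_later := fun τ _ _ => Nat.lt_succ_self τ
    sent_timely := fun τ _ _ _ _ => htime τ
    sent_honest := by
      intro τ i hi j
      have hsent : (silentRun α ω p M b Δ D B).sent τ i j =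
          ((silentPhase F N M K nX b Δ B τ).1 i).sends b (Δ + 1) i := if_neg hi
      rw [hsent]
      ext c
      constructor
      · intro hc
        refine ⟨hc, ?_⟩
        rcases hc with hc | hc
        · exact Or.inl hc.1
        · obtain ⟨σ, hσ, hc⟩ := (mem_known_silentPhase τ i c).1 hc
          exact Or.inr ⟨σ, hσ, by rwa [inbox_silentRun]⟩
      · exact fun hc => hc.1
    sent_faulty := by
      intro τ i hi j c hc
      have hsent : (silentRun α ω p M b Δ D B).sent τ i j = ∅ := if_pos hi
      rw [hsent] at hc
      exact absurd hc (Set.notMem_empty c)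
    st_zero := fun _ _ => rfl
    st_succ := fun τ i _ => by
      rw [inbox_silentRun]
      rfl
    round_zero := fun _ _ => rfl
    store_zero := fun _ _ => rfl
    complete := fun τ i _ t x e h => absurd h (hcompl i τ t x e)
    idle := fun _ _ _ _ => ⟨rfl, rfl⟩
    result_self := fun i _ τ t g h => absurd h (hcomp i τ t g)
    result_other := fun i _ τ t g h => absurd h (hcomp i τ t g)
    result_only := fun _ _ _ _ _ _ h => nomatch h
    reply_sent := fun i _ τ t x e h => absurd h (hcompl i τ t x e)
    reply_only := fun _ _ _ _ _ _ _ h => nomatch h }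

theorem not_liveness_silentRun (hM : 1 ≤ M) (hK : 1 ≤ K) (D : ℕ) :
    ¬ (silentRun α ω p M b Δ D B).Liveness B := by
  intro h
  obtain ⟨t, -, τ, y, hy⟩ := h 0 ⟨0, hM⟩ ⟨0, hK⟩ 0 rfl
  have hcard : b < (reporters (fun _ : Fin N => none) y).card :=
    pick_spec (p := fun y => b < (reporters (fun _ : Fin N => none) y).card) hy
  obtain ⟨i, hi⟩ := Finset.card_pos.1 (Nat.zero_lt_of_lt hcard)
  exact nomatch mem_reporters.1 hi

/-- The coded scheme with parameter `b` does not tolerate more than `b` faulty nodes. -/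
theorem le_of_secure_codedScheme (hM : 1 ≤ M) (hK : 1 ≤ K) (hΔ : 1 ≤ Δ) {D b' : ℕ} (hN : b < N)
    (h : (codedScheme M α ω p b Δ D).Secure Δ p.step b') : b' ≤ b := by
  by_contra! hlt
  obtain ⟨B, -, hB⟩ := Finset.exists_subset_card_eq (s := (Finset.univ : Finset (Fin N)))
    (n := b + 1) (by rw [Finset.card_fin]; omega)
  exact not_liveness_silentRun α ω p hM hK D
    (h B (by omega) _ (isRun_silentRun α ω p hM hΔ (by omega) D)).2.2.2

end silent

/-! ## Numbers of machines and of faults -/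

/-- Clearing the denominator turns the capacity bound into d(K-1) + 1 ≤ (1-3ν)N, and 3⌊νN⌋ ≤ 3νN. -/
theorem degree_bound_of_le_capacity {ν : ℝ} (hν₀ : 0 ≤ ν) {d : ℕ} (hd : 1 ≤ d) {N K : ℕ}
    (hK : 1 ≤ K) (h : K ≤ capacity ν d N) : d * (K - 1) + 3 * ⌊ν * N⌋₊ < N := by
  obtain ⟨k, rfl⟩ : ∃ k, K = k + 1 := ⟨K - 1, by omega⟩
  have hd' : (0 : ℝ) < d := by exact_mod_cast hd
  have h1 : ((k + 1 : ℕ) : ℝ) ≤ (1 - 3 * ν) / d * N + 1 - 1 / d :=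
    (Nat.le_floor_iff' (by omega)).1 h
  have h2 : (⌊ν * N⌋₊ : ℝ) ≤ ν * N := Nat.floor_le (by positivity)
  have h3 : (d : ℝ) * k + 1 ≤ (1 - 3 * ν) * N := by
    push_cast at h1
    have h4 : (k : ℝ) ≤ ((1 - 3 * ν) * N - 1) / d := by
      rw [sub_div, mul_div_right_comm]
      linarith
    rw [le_div_iff₀ hd'] at h4
    linarith
  have h4 : ((d * k + 3 * ⌊ν * N⌋₊ + 1 : ℕ) : ℝ) ≤ N := by
    push_cast
    linarith
  exact_mod_cast h4

theorem isTheta_natFloor {c a : ℝ} (hc : 0 < c) (ha : 0 ≤ a) (ha' : a ≤ 1) :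
    (fun N : ℕ => (⌊c * N + a⌋₊ : ℝ)) =Θ[atTop] (fun N : ℕ => (N : ℝ)) := by
  constructor
  · refine IsBigO.of_bound (c + 1) ?_
    filter_upwards [eventually_ge_atTop 1] with N hN
    have hN' : (1 : ℝ) ≤ N := by exact_mod_cast hN
    have := Nat.floor_le (show 0 ≤ c * N + a by positivity)
    rw [Real.norm_natCast, Real.norm_natCast]
    linarith
  · refine IsBigO.of_bound (2 / c) ?_
    -- From here on cN ≥ 2, so the floor exceeds cN - 1 ≥ cN/2.
    filter_upwards [eventually_ge_atTop ⌈2 / c⌉₊] with N hN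
    have hN' : 2 / c ≤ N := (Nat.le_ceil _).trans (by exact_mod_cast hN)
    have := Nat.lt_floor_add_one (c * N + a)
    rw [Real.norm_natCast, Real.norm_natCast, div_mul_eq_mul_div, le_div_iff₀ hc]
    rw [div_le_iff₀ hc] at hN'
    linarith

end CodedSM

/-! ### Assembly of the theorem -/

theorem theorem2 (ν : ℝ) (hν₀ : 0 ≤ ν) (hν : ν < 1 / 3) (d : ℕ) (hd : 1 ≤ d) :
    (∀ (F : Type u) [Field F] (N M nS nX nY Δ : ℕ), (N : ℕ∞) ≤ ENat.card F →
      1 ≤ M → 1 ≤ nS → 1 ≤ Δ →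
      ∀ p : CodedSM.PolyMachine F nS nX nY, p.DegreeLE d →
      ∀ K : ℕ, 1 ≤ K → K ≤ CodedSM.capacity ν d N →
        ∃ P : CodedSM.Scheme F N M K nS nX nY,
          P.storageEfficiency = K ∧
          IsGreatest {b : ℕ | P.Secure Δ p.step b} ⌊ν * N⌋₊) ∧
    (fun N : ℕ => (CodedSM.capacity ν d N : ℝ)) =Θ[atTop] (fun N : ℕ => (N : ℝ)) ∧
    (0 < ν → (fun N : ℕ => (⌊ν * N⌋₊ : ℝ)) =Θ[atTop] (fun N : ℕ => (N : ℝ))) := by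
  have hd' : (1 : ℝ) ≤ d := by exact_mod_cast hd
  refine ⟨?_, ?_, ?_⟩
  · intro F _ N M nS nX nY Δ hF hM hnS hΔ p hp K hK hKN
    have hD := CodedSM.degree_bound_of_le_capacity hν₀ hd hK hKN
    have hKN' : K ≤ N := by
      have := Nat.le_mul_of_pos_left (K - 1) hd
      omega
    obtain ⟨α⟩ : Nonempty (Fin N ↪ F) := by
      rw [← Cardinal.lift_mk_le', Cardinal.mk_fin, Cardinal.lift_natCast, Cardinal.lift_uzero]
      exact Cardinal.natCast_le_toENat.1 hF
    -- The interpolation points are the first `K` evaluation points. Decoding never needs the two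
    -- sets to be disjoint, so `N` field elements are enough.
    exact ⟨CodedSM.codedScheme M α ((Fin.castLEEmb hKN').trans α) p ⌊ν * N⌋₊ Δ (d * (K - 1)),
      CodedSM.storageEfficiency_codedScheme _ _ _ _ _ _ hnS,
      CodedSM.secure_codedScheme M Δ hD (p.natDegree_codeword_le hp _),
      fun b' h => CodedSM.le_of_secure_codedScheme _ _ _ hM hK hΔ (by omega) h⟩
  · have h1 : (1 : ℝ) / d ≤ 1 := (div_le_one (by linarith)).2 hd'
    have h := CodedSM.isTheta_natFloor (c := (1 - 3 * ν) / d) (a := 1 - 1 / d)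
      (div_pos (by linarith) (by linarith)) (by linarith)
        (by linarith [show (0 : ℝ) < 1 / d by positivity])
    simpa only [CodedSM.capacity, add_sub_assoc] using h
  · intro hν'
    simpa only [add_zero] using CodedSM.isTheta_natFloor hν' le_rfl zero_le_one
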